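/- Let $(\Omega,\mathcal F,\mathbb P)$ be a probability space with a filtration $(\mathcal G_t)_{t\ge 0}$, let $S_t>0$ be the $\mathcal G_t$-measurable price of an asset and $R_{t+1}=\log(S_{t+1}/S_t)$. Suppose that under $\mathbb P$ returns follow the Heston--Nandi GARCH model $$R_{t+1}=r+(\lambda-\tfrac12)h_{t+1}+\sqrt{h_{t+1}}\,z_{t+1}\ (t\ge 0),\qquad h_{t+1}=\omega+\beta h_t+\alpha(z_t-\gamma\sqrt{h_t})^2\ (t\ge 1),$$ where $\alpha>0$, $\omega,\beta\ge 0$, $h_{t+1}$ is $\mathcal G_t$-measurable, $h_1>0$ a.s., and $z_{t+1}\sim N(0,1)$ is $\mathcal G_{t+1}$-measurable and independent of $\mathcal G_t$. Let the pricing kernel be $$M_{t+1,t}=\frac{\exp(\phi_tR_{t+1}+\xi_th_{t+2})}{\mathbb E^{\mathbb P}_t[\exp(\phi_tR_{t+1}+\xi_th_{t+2})]},\qquad \mathbb E^{\mathbb P}_t=\mathbb E^{\mathbb P}(\cdot\mid\mathcal G_t),$$ with $\phi_t,\xi_t$ $\mathcal G_t$-measurable, finite denominators, and no arbitrage: $\mathbb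 E^{\mathbb P}_t[M_{t+1,t}e^{R_{t+1}}]=e^r$. Put $\eta_t=(1-2\alpha\xi_t)^{-1}$ and $h^*_{t+1}=\eta_th_{t+1}$. Fix $t\ge 0$, $M\ge 1$, $T=t+M$ and $K>0$, and let $\mathbb Q$ be the risk-neutral measure, a probability measure whose density with respect to $\mathbb P$ on $\mathcal G_T$ is $\prod_{j=0}^{T-1}M_{j+1,j}$. Conditional expectations are means of regular conditional laws. Suppose that the path $\eta_{t+1:t+M}=(\eta_{t+1},\dots,\eta_{t+M})$ is predetermined, that is, $\mathcal G_t$-measurable. Let $g^*_{t,M}(s)=\mathbb E^{\mathbb Q}_t[\exp(s\sum_{i=1}^MR_{t+i})]$ be the moment generating function of the cumulative return under $\mathbb Q$. Then, almost surely: (1) the price $e^{-rM}\,\mathbb E^{\mathbb Q}_t[(S_{t+M}-K)^+]$ at time $t$ of the European call with strike $K$ and $M$ periods to maturity is well defined and equals $$S_tP_1(t)-Ke^{-rM}P_2(t),$$ where $$P_1(t)=\frac12+\frac{e^{-rM}}{\pi}\int_0^\infty\mathrm{Re}\left[\frac{K^{-i\varphi}\,S_t^{\,i\varphi+1}g^*_{t,M}(i\varphi+1)}{i\varphi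 S_t}\right]d\varphi,\qquad P_2(t)=\frac12+\frac1\pi\int_0^\infty\mathrm{Re}\left[\frac{K^{-i\varphi}\,S_t^{\,i\varphi}g^*_{t,M}(i\varphi)}{i\varphi}\right]d\varphi,$$ both integrals being absolutely convergent; (2) $g^*_{t,M}(s)$ exists for $0\le\mathrm{Re}\,s\le1$, and for every complex $s$ for which it exists (that is, for which $\mathbb E^{\mathbb Q}_t[\exp(\mathrm{Re}(s)\sum_{i=1}^MR_{t+i})]<\infty$) $$g^*_{t,M}(s)=\exp\big(\mathcal A_T(s,M)+\mathcal B_T(s,M)h^*_{t+1}\big).$$ Here $\mathcal A_T(s,1)=sr$, $\mathcal B_T(s,1)=\frac12(s^2-s)$ and, for $1\le m<M$, with the principal logarithm, $$\mathcal A_T(s,m+1)=\mathcal A_T(s,m)+sr+\mathcal B_T(s,m)\omega^*_{T-m}-\tfrac12\log\big(1-2\alpha^*_{T-m}\mathcal B_T(s,m)\big),$$ $$\mathcal B_T(s,m+1)=s(\gamma^*_{T-m-1}-\tfrac12)-\tfrac12\gamma^{*2}_{T-m-1}+\beta^*_{T-m}\mathcal B_T(s,m)+\frac{(s-\gamma^*_{T-m-1})^2}{2(1-2\alpha^*_{T-m}\mathcal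 B_T(s,m))},$$ with $\omega^*_\tau=\omega\eta_\tau$, $\beta^*_\tau=\beta\eta_\tau/\eta_{\tau-1}$, $\alpha^*_\tau=\alpha\eta_\tau\eta_{\tau-1}$ and $\gamma^*_\tau=\frac1{\eta_\tau}(\gamma+\lambda-\frac12)+\frac12$. -/

import Mathlib

open MeasureTheory ProbabilityTheory

namespace HNOption

noncomputable section

/-- Parameters of the Heston-Nandi GARCH model; `r` is the risk-free rate per period and `lam`
the equity risk premium. -/
structure Params where
  r : ℝ
  lam : ℝ
  omega : ℝ
  beta : ℝ
  alpha : ℝ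
  gamma : ℝ

section Conditional

variable {Ω : Type*} {mΩ : MeasurableSpace Ω}

/-- The regular conditional law, under `μ`, of the real random variable `Y` given the
sub-σ-algebra `m`. -/
def condLaw (μ : Measure Ω) [IsFiniteMeasure μ] (m : MeasurableSpace Ω) (Y : Ω → ℝ) (ω : Ω) :
    Measure ℝ :=
  @condDistrib Ω Ω ℝ _ _ _ mΩ m Y id μ _ ω

/-- The conditional expectation of `Y` given `m`, as the mean of the regular conditional law.
It is meaningful as soon as the conditional law has a finite mean, even when `Y` itself is not
integrable. -/
def condMean (μ : Measure Ω) [IsFiniteMeasure μ] (m : MeasurableSpace Ω) (Y : Ω → ℝ) (ω : Ω) : ℝ :=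
  ∫ y, y ∂(condLaw μ m Y ω)

/-- The conditional moment generating function `s ↦ E[exp (s Y) | m]` at a complex argument. -/
def condMGF (μ : Measure Ω) [IsFiniteMeasure μ] (m : MeasurableSpace Ω) (Y : Ω → ℝ) (ω : Ω)
    (s : ℂ) : ℂ :=
  complexMGF id (condLaw μ m Y ω) s

end Conditional

section Model

variable {Ω : Type*} {mΩ : MeasurableSpace Ω}

/-- `logReturn S t` is the return `R_{t+1} = log (S_{t+1} / S_t)`. -/
def logReturn (S : ℕ → Ω → ℝ) (t : ℕ) (ω : Ω) : ℝ :=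
  Real.log (S (t + 1) ω / S t ω)

/-- The cumulative return `R_{t+1} + ⋯ + R_{t+M}`. -/
def cumReturn (S : ℕ → Ω → ℝ) (t M : ℕ) (ω : Ω) : ℝ :=
  ∑ i ∈ Finset.range M, logReturn S (t + i) ω

/-- The Heston-Nandi GARCH model under `P`. `S t` is the price at time `t`, `h (t + 1)` the variance
of the return `R_{t+1}` (known at time `t`), `z (t + 1)` its standard normal shock; `h 0` and `z 0`
play no role. The information `𝒢` may be larger than the one generated by the returns (it may
contain derivative prices), the shocks being independent of past information. -/
structure IsHestonNandi (P : Measure Ω) (𝒢 : Filtration ℕ mΩ) (p : Params)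
    (S h z : ℕ → Ω → ℝ) : Prop where
  price_pos : ∀ t ω, 0 < S t ω
  price_adapted : ∀ t, Measurable[𝒢 t] (S t)
  variance_predictable : ∀ t, Measurable[𝒢 t] (h (t + 1))
  shock_adapted : ∀ t, Measurable[𝒢 (t + 1)] (z (t + 1))
  shock_law : ∀ t, P.map (z (t + 1)) = gaussianReal 0 1
  shock_indep : ∀ t, Indep (MeasurableSpace.comap (z (t + 1)) inferInstance) (𝒢 t) P
  initial_variance_pos : ∀ᵐ ω ∂P, 0 < h 1 ω
  return_eq : ∀ t, ∀ᵐ ω ∂P, logReturn S t ω =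
    p.r + (p.lam - 1 / 2) * h (t + 1) ω + Real.sqrt (h (t + 1) ω) * z (t + 1) ω
  variance_eq : ∀ t, ∀ᵐ ω ∂P, h (t + 2) ω =
    p.omega + p.beta * h (t + 1) ω
      + p.alpha * (z (t + 1) ω - p.gamma * Real.sqrt (h (t + 1) ω)) ^ 2

/-- `exp (φ_t R_{t+1} + ξ_t h_{t+2})`. -/
def kernelNumerator (S h φ ξ : ℕ → Ω → ℝ) (t : ℕ) (ω : Ω) : ℝ :=
  Real.exp (φ t ω * logReturn S t ω + ξ t ω * h (t + 2) ω)

/-- The one-period pricing kernel `M_{t+1,t}`. -/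
def pricingKernel (P : Measure Ω) [IsFiniteMeasure P] (𝒢 : Filtration ℕ mΩ)
    (S h φ ξ : ℕ → Ω → ℝ) (t : ℕ) (ω : Ω) : ℝ :=
  kernelNumerator S h φ ξ t ω / condMean P (𝒢 t) (kernelNumerator S h φ ξ t) ω

/-- The coefficients `φ_t`, `ξ_t` are known at time `t`, the conditional expectation in the pricing
kernel is finite, and the kernel prices the underlying asset: `E_t^P[M_{t+1,t} e^{R_{t+1}}] = e^r`
(absence of arbitrage). -/
structure IsPricingKernel (P : Measure Ω) [IsFiniteMeasure P] (𝒢 : Filtration ℕ mΩ) (p : Params)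
    (S h φ ξ : ℕ → Ω → ℝ) : Prop where
  phi_adapted : ∀ t, Measurable[𝒢 t] (φ t)
  xi_adapted : ∀ t, Measurable[𝒢 t] (ξ t)
  finite_condMean : ∀ t, ∀ᵐ ω ∂P,
    Integrable (fun y : ℝ => y) (condLaw P (𝒢 t) (kernelNumerator S h φ ξ t) ω)
  no_arbitrage : ∀ t, ∀ᵐ ω ∂P,
    condMean P (𝒢 t)
      (fun ω' => pricingKernel P 𝒢 S h φ ξ t ω' * Real.exp (logReturn S t ω')) ω = Real.exp p.r

/-- `Q` is the risk-neutral measure up to time `T`: on `𝒢 T` it has the density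
`M_{1,0} M_{2,1} ⋯ M_{T,T-1}` with respect to `P`. -/
def IsRiskNeutral (P Q : Measure Ω) [IsFiniteMeasure P] (𝒢 : Filtration ℕ mΩ)
    (S h φ ξ : ℕ → Ω → ℝ) (T : ℕ) : Prop :=
  ∀ A : Set Ω, MeasurableSet[𝒢 T] A →
    Q A = ∫⁻ ω in A,
      ENNReal.ofReal (∏ j ∈ Finset.range T, pricingKernel P 𝒢 S h φ ξ j ω) ∂P

/-- The variance risk ratio `η_t = (1 - 2 α ξ_t)⁻¹`. -/
def varianceRiskRatio (p : Params) (ξ : ℕ → Ω → ℝ) (t : ℕ) (ω : Ω) : ℝ :=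
  (1 - 2 * p.alpha * ξ t ω)⁻¹

/-- The payoff of a European call with strike `K` and maturity `T`. -/
def callPayoff (S : ℕ → Ω → ℝ) (K : ℝ) (T : ℕ) (ω : Ω) : ℝ :=
  max (S T ω - K) 0

/-- The price at time `t` of a European call with strike `K` and `M` periods to maturity:
`e^{-rM} E_t^Q[(S_{t+M} - K)⁺]`. -/
def callPrice (Q : Measure Ω) [IsFiniteMeasure Q] (𝒢 : Filtration ℕ mΩ) (r : ℝ)
    (S : ℕ → Ω → ℝ) (t M : ℕ) (K : ℝ) (ω : Ω) : ℝ :=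
  Real.exp (-r * M) * condMean Q (𝒢 t) (callPayoff S K (t + M)) ω

end Model

section Recursion

/-- `ω*_τ`, along a path `η` of the variance risk ratio. -/
def omegaStar (p : Params) (η : ℕ → ℝ) (τ : ℕ) : ℝ := p.omega * η τ

/-- `β*_τ` (used for `τ ≥ 1`). -/
def betaStar (p : Params) (η : ℕ → ℝ) (τ : ℕ) : ℝ := p.beta * (η τ / η (τ - 1))

/-- `α*_τ` (used for `τ ≥ 1`). -/
def alphaStar (p : Params) (η : ℕ → ℝ) (τ : ℕ) : ℝ := p.alpha * η τ * η (τ - 1)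

/-- `γ*_τ`. -/
def gammaStar (p : Params) (η : ℕ → ℝ) (τ : ℕ) : ℝ :=
  1 / η τ * (p.gamma + p.lam - 1 / 2) + 1 / 2

/-- `B_T(s, m)` for `1 ≤ m ≤ T`; the value at `m = 0` is not used. -/
def coefB (p : Params) (η : ℕ → ℝ) (T : ℕ) (s : ℂ) : ℕ → ℂ
  | 0 => 0
  | 1 => 1 / 2 * (s ^ 2 - s)
  | m + 2 =>
    s * ((gammaStar p η (T - (m + 1) - 1) : ℂ) - 1 / 2)
      - 1 / 2 * (gammaStar p η (T - (m + 1) - 1) : ℂ) ^ 2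
      + (betaStar p η (T - (m + 1)) : ℂ) * coefB p η T s (m + 1)
      + (s - (gammaStar p η (T - (m + 1) - 1) : ℂ)) ^ 2
        / (2 * (1 - 2 * (alphaStar p η (T - (m + 1)) : ℂ) * coefB p η T s (m + 1)))

/-- `A_T(s, m)` for `1 ≤ m ≤ T` (principal logarithm); the value at `m = 0` is not used. -/
def coefA (p : Params) (η : ℕ → ℝ) (T : ℕ) (s : ℂ) : ℕ → ℂ
  | 0 => 0
  | 1 => s * p.r
  | m + 2 =>
    coefA p η T s (m + 1) + s * p.r
      + coefB p η T s (m + 1) * (omegaStar p η (T - (m + 1)) : ℂ)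
      - 1 / 2 * Complex.log
          (1 - 2 * (alphaStar p η (T - (m + 1)) : ℂ) * coefB p η T s (m + 1))

end Recursion

section Inversion

/-- The integrand of `P₁`; `x` is the current price of the underlying asset and `g` the moment
generating function of the cumulative return, so that `x ^ s * g s` is that of the log-price at
maturity. -/
def integrandP1 (K x : ℝ) (g : ℂ → ℂ) (u : ℝ) : ℝ :=
  ((K : ℂ) ^ (-(Complex.I * u)) * ((x : ℂ) ^ (Complex.I * u + 1) * g (Complex.I * u + 1))
    / (Complex.I * u * x)).re

/-- The integrand of `P₂`. -/
def integrandP2 (K x : ℝ) (g : ℂ → ℂ) (u : ℝ) : ℝ :=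
  ((K : ℂ) ^ (-(Complex.I * u)) * ((x : ℂ) ^ (Complex.I * u) * g (Complex.I * u))
    / (Complex.I * u)).re

def probP1 (r : ℝ) (M : ℕ) (K x : ℝ) (g : ℂ → ℂ) : ℝ :=
  1 / 2 + Real.exp (-r * M) / Real.pi * ∫ u in Set.Ioi (0 : ℝ), integrandP1 K x g u

def probP2 (K x : ℝ) (g : ℂ → ℂ) : ℝ :=
  1 / 2 + 1 / Real.pi * ∫ u in Set.Ioi (0 : ℝ), integrandP2 K x g u

end Inversion

end

end HNOption

/-!
Given `𝒢 t`, each pricing kernel `M_{t+1,t}` is the exponential of a quadratic polynomial in the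
shock `z_{t+1}`, normalised by its Gaussian integral. Finiteness of that integral forces
`2 α ξ_t < 1`, so `η_t > 0`, and the kernel turns the standard normal law of the shock into a normal
law of variance `η_t` (`lintegral_tilted_gaussian`), whose mean is determined by absence of
arbitrage (`tilt_mean_eq`). Rewritten in the standardised shock, returns under `Q` again follow a
Heston-Nandi recursion, with the starred parameters and the variance `h* = η h` (`stepFun_eq`).

When the path of `η` is predetermined, it can be frozen: the conditional law under `Q` of the
cumulative return given `𝒢 t` is the law of a Markov chain with deterministic, time-dependent
coefficients (`IsRiskNeutral.hasCondKernel`, `IsRiskNeutral.condLaw_ae_eq`). Identifying the law,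
rather than the conditional expectation for one exponent at a time, gives the statement for all
complex exponents off a single null set, and leaves a deterministic problem for `returnLaw`.

The moment generating function is computed backwards by Gaussian integrals
(`integral_exp_chain`). They converge precisely when `2 α* B(σ, k) < 1` along the recursion at the
real exponent `σ = Re s` (`GoodExponent`), which is also necessary for the moment of order `σ` to be
finite (`goodExponent_of_integrable`). For complex `s` one has `Re B(s, k) ≤ B(Re s, k)`
(`coefB_re_le`); hence `1 - 2 α* B(s, k)` has positive real part and the principal logarithm is the
right branch. At `σ = 0` and `σ = 1` all the `B(σ, k)` vanish, so that by continuity the moments are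
finite in a neighbourhood of `[0, 1]`; on the lines `Re s = 0, 1` the moment generating function is
`O(1 / |Im s|)` (`exists_exponent_re_le`).

The payoff `(S_T - K)⁺` is `S_T - K` times `(1 + sign (log (S_T / K))) / 2`, and Fourier inversion of
the sign function (`integral_sin_div_eq_sign`), under the weights `1` and `S_T / S_t`, yields `P₂`
and `P₁` (`call_price_formula`). The decay above and the first moments make the integrals absolutely
convergent.
-/

namespace HNOption

open scoped NNReal ENNReal

/-! ### Exponentials of quadratic polynomials under the standard normal law -/

lemma gaussianPDFReal_std (y : ℝ) :
    gaussianPDFReal 0 1 y = (Real.sqrt (2 * Real.pi))⁻¹ * Real.exp (-(1 / 2) * y ^ 2) := by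
  simp only [gaussianPDFReal, NNReal.coe_one, mul_one, sub_zero]
  congr 2; ring

lemma integrable_gaussianReal_iff {E : Type*} [NormedAddCommGroup E] [NormedSpace ℝ E]
    (f : ℝ → E) :
    Integrable f (gaussianReal 0 1) ↔ Integrable (fun y => gaussianPDFReal 0 1 y • f y) := by
  rw [gaussianReal_of_var_ne_zero _ one_ne_zero,
    integrable_withDensity_iff_integrable_smul' (measurable_gaussianPDF _ _)
      (ae_of_all _ fun _ => gaussianPDF_lt_top)]
  simp

lemma smul_cexp_quadratic (b c d : ℂ) (y : ℝ) :
    gaussianPDFReal 0 1 y • Complex.exp (b * (y : ℂ) ^ 2 + c * y + d)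
      = (((Real.sqrt (2 * Real.pi))⁻¹ : ℝ) : ℂ) *
          Complex.exp ((b - 1 / 2) * (y : ℂ) ^ 2 + c * y + d) := by
  rw [gaussianPDFReal_std, Complex.real_smul]
  push_cast
  rw [mul_assoc, ← Complex.exp_add]
  congr 2; ring

lemma integrable_cexp_quadratic_gaussian {b : ℂ} (hb : b.re < 1 / 2) (c d : ℂ) :
    Integrable (fun y : ℝ => Complex.exp (b * (y : ℂ) ^ 2 + c * y + d)) (gaussianReal 0 1) := by
  rw [integrable_gaussianReal_iff]
  simp_rw [smul_cexp_quadratic]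
  refine Integrable.const_mul ?_ _
  have := integrable_cexp_quadratic (b := 1 / 2 - b) (by simpa using hb) c d
  simpa using this

/-- For `Re q > 0` the principal branches combine as if `q` were a positive real number. -/
lemma cpow_half_two_pi_div {q : ℂ} (hq : 0 < q.re) :
    (((Real.sqrt (2 * Real.pi))⁻¹ : ℝ) : ℂ) * ((Real.pi : ℂ) / (q / 2)) ^ (1 / 2 : ℂ)
      = Complex.exp (-(1 / 2) * Complex.log q) := by
  have hq0 : q ≠ 0 := by rintro rfl; simp at hq
  have h2pi : (0 : ℝ) < 2 * Real.pi := by positivity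
  have harg : q.arg ≠ Real.pi := by
    rw [Ne, Complex.arg_eq_pi_iff, not_and_or, not_lt]; exact Or.inl hq.le
  have e1 : (Real.pi : ℂ) / (q / 2) = ((2 * Real.pi : ℝ) : ℂ) * q⁻¹ := by
    push_cast; field_simp
  have e2 : Complex.log (((2 * Real.pi : ℝ) : ℂ) * q⁻¹)
      = ((Real.log (2 * Real.pi) : ℝ) : ℂ) - Complex.log q := by
    rw [Complex.log_ofReal_mul h2pi (inv_ne_zero hq0), Complex.log_inv _ harg]
    ring
  have hne : ((2 * Real.pi : ℝ) : ℂ) * q⁻¹ ≠ 0 :=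
    mul_ne_zero (by exact_mod_cast h2pi.ne') (inv_ne_zero hq0)
  have e3 : (((Real.sqrt (2 * Real.pi))⁻¹ : ℝ) : ℂ)
      = Complex.exp (((-(1 / 2) * Real.log (2 * Real.pi) : ℝ) : ℂ)) := by
    rw [← Complex.ofReal_exp]
    congr 1
    rw [Real.sqrt_eq_rpow, ← Real.rpow_neg h2pi.le, Real.rpow_def_of_pos h2pi]
    congr 1; ring
  rw [e1, Complex.cpow_def_of_ne_zero hne, e2, e3, ← Complex.exp_add]
  congr 1; push_cast; ring

lemma integral_cexp_quadratic_gaussian {b : ℂ} (hb : b.re < 1 / 2) (c d : ℂ) :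
    ∫ y : ℝ, Complex.exp (b * (y : ℂ) ^ 2 + c * y + d) ∂(gaussianReal 0 1)
      = Complex.exp (d + c ^ 2 / (2 * (1 - 2 * b)) - 1 / 2 * Complex.log (1 - 2 * b)) := by
  have hb' : (b - 1 / 2).re < 0 := by simpa using hb
  have hq : 0 < (1 - 2 * b).re := by simp; linarith
  have hq0 : (1 - 2 * b) ≠ 0 := by intro h; rw [h] at hq; simp at hq
  rw [integral_gaussianReal_eq_integral_smul one_ne_zero]
  simp_rw [smul_cexp_quadratic]
  rw [integral_const_mul, integral_cexp_quadratic hb', ← mul_assoc,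
    show -(b - 1 / 2) = (1 - 2 * b) / 2 by ring, cpow_half_two_pi_div hq, ← Complex.exp_add]
  congr 1
  have h4 : 4 * (b - 1 / 2) = -(2 * (1 - 2 * b)) := by ring
  rw [h4, div_neg]; ring

/-- Converse of `integrable_cexp_quadratic_gaussian` for real coefficients; in the boundary case
`b = 1 / 2` the integrand against Lebesgue measure is `exp (c y + d)`, still not integrable. -/
lemma lt_half_of_integrable_exp_quadratic {b c d : ℝ}
    (h : Integrable (fun y : ℝ => Real.exp (b * y ^ 2 + c * y + d)) (gaussianReal 0 1)) :
    b < 1 / 2 := by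
  by_contra! hb
  rw [integrable_gaussianReal_iff] at h
  -- on the half-line where `c * y ≥ 0` the integrand is bounded below by a positive constant
  set k : ℝ := (Real.sqrt (2 * Real.pi))⁻¹ * Real.exp d with hk
  have hkpos : 0 < k := by positivity
  have hbound : ∀ y : ℝ, 0 ≤ c * y →
      k ≤ gaussianPDFReal 0 1 y • Real.exp (b * y ^ 2 + c * y + d) := by
    intro y hy
    rw [gaussianPDFReal_std, smul_eq_mul, mul_assoc, ← Real.exp_add, hk]
    gcongr
    nlinarith [sq_nonneg y]
  obtain ⟨s, hs, hsv⟩ : ∃ s : Set ℝ, (∀ y ∈ s, 0 ≤ c * y) ∧ MeasurableSet s ∧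
      (volume : Measure ℝ) s = ∞ := by
    rcases le_total 0 c with hc | hc
    · exact ⟨Set.Ioi 0, fun y hy => mul_nonneg hc (le_of_lt hy), measurableSet_Ioi,
        Real.volume_Ioi⟩
    · exact ⟨Set.Iio 0, fun y hy => mul_nonneg_of_nonpos_of_nonpos hc (le_of_lt hy),
        measurableSet_Iio, Real.volume_Iio⟩
  have hc : IntegrableOn (fun _ : ℝ => k) s :=
    Integrable.mono' h.integrableOn aestronglyMeasurable_const
      ((ae_restrict_iff' hsv.1).2 (ae_of_all _ fun y hy => by
        rw [Real.norm_of_nonneg hkpos.le]; exact hbound y (hs y hy)))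
  rw [integrableOn_const_iff] at hc
  rcases hc with hc | hc
  · simp only [enorm_eq_zero] at hc; exact hkpos.ne' hc
  · rw [hsv.2] at hc; exact absurd hc (lt_irrefl _)

lemma lintegral_gaussianReal_std {f : ℝ → ℝ≥0∞} (hf : Measurable f) (m : ℝ) {v : ℝ}
    (hv : 0 < v) :
    ∫⁻ y, f (m + Real.sqrt v * y) ∂(gaussianReal 0 1) =
      ∫⁻ y, ENNReal.ofReal (gaussianPDFReal m v.toNNReal y) * f y := by
  have hmap : (gaussianReal 0 1).map (fun y => m + Real.sqrt v * y)
      = gaussianReal m v.toNNReal := by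
    have : (fun y : ℝ => m + Real.sqrt v * y) = (m + ·) ∘ (Real.sqrt v * ·) := rfl
    rw [this, ← Measure.map_map (by fun_prop) (by fun_prop), gaussianReal_map_const_mul,
      gaussianReal_map_const_add]
    congr 1
    · simp
    · ext; simp [Real.sq_sqrt hv.le, hv.le]
  rw [← lintegral_map hf (by fun_prop), hmap, gaussianReal_of_var_ne_zero,
    lintegral_withDensity_eq_lintegral_mul _ (measurable_gaussianPDF _ _) hf]
  · rfl
  · simpa using hv

/-- Exponential tilting: weighting the standard normal law by a normalised exponential of a
quadratic polynomial gives again a normal law, of variance `(1 - 2 b)⁻¹`. -/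
lemma lintegral_tilted_gaussian {b : ℝ} (hb : b < 1 / 2) (c d : ℝ) {f : ℝ → ℝ≥0∞}
    (hf : Measurable f) :
    ∫⁻ y, ENNReal.ofReal (Real.exp (b * y ^ 2 + c * y + d) /
        ∫ y', Real.exp (b * y' ^ 2 + c * y' + d) ∂(gaussianReal 0 1)) * f y ∂(gaussianReal 0 1)
      = ∫⁻ y, f (c * (1 - 2 * b)⁻¹ + Real.sqrt (1 - 2 * b)⁻¹ * y) ∂(gaussianReal 0 1) := by
  have hv : 0 < (1 - 2 * b)⁻¹ := by rw [inv_pos]; linarith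
  set v := (1 - 2 * b)⁻¹ with hvdef
  have hbv : b = 1 / 2 - 1 / (2 * v) := by
    rw [hvdef]; have : (1 - 2 * b) ≠ 0 := by linarith
    field_simp; ring
  set C := Real.exp (d + c ^ 2 * v / 2) * Real.sqrt v with hC
  have hCpos : 0 < C := by positivity
  have key : ∀ y, gaussianPDFReal 0 1 y * Real.exp (b * y ^ 2 + c * y + d)
      = C * gaussianPDFReal (c * v) v.toNNReal y := by
    intro y
    rw [gaussianPDFReal_std, gaussianPDFReal, hC]
    simp only [Real.coe_toNNReal _ hv.le]
    rw [Real.sqrt_mul (by positivity) v, mul_assoc, ← Real.exp_add]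
    have hs : Real.sqrt v ≠ 0 := (Real.sqrt_pos.2 hv).ne'
    have hp : Real.sqrt (2 * Real.pi) ≠ 0 := by positivity
    have : -(1 / 2) * y ^ 2 + (b * y ^ 2 + c * y + d)
        = (d + c ^ 2 * v / 2) + -(y - c * v) ^ 2 / (2 * v) := by
      rw [hbv]; field_simp; ring
    rw [this, Real.exp_add]
    field_simp
  have hnorm : ∫ y', Real.exp (b * y' ^ 2 + c * y' + d) ∂(gaussianReal 0 1) = C := by
    rw [integral_gaussianReal_eq_integral_smul one_ne_zero]
    simp_rw [smul_eq_mul, key]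
    rw [integral_const_mul, integral_gaussianPDFReal_eq_one, mul_one]
    simpa using hv
  rw [hnorm, lintegral_gaussianReal_std hf _ hv, gaussianReal_of_var_ne_zero _ one_ne_zero,
    lintegral_withDensity_eq_lintegral_mul _ (measurable_gaussianPDF _ _) (by fun_prop)]
  refine lintegral_congr fun y => ?_
  simp only [Pi.mul_apply, gaussianPDF]
  rw [← mul_assoc, ← ENNReal.ofReal_mul (gaussianPDFReal_nonneg _ _ _)]
  congr 2
  rw [mul_div_assoc', key, mul_div_cancel_left₀ _ hCpos.ne']

/-! ### Conditional laws of functions of a conditioned variable -/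

/-- If `κ (X i)` is the conditional law of `W` given `I = i`, then that of `F (X i, W)` is its
image. The σ-algebra of `Ω'` plays the role of the conditioning one, so that `I` may be the identity from a
σ-algebra to a smaller one. -/
lemma condDistrib_ae_eq_map {Ω Ω' α β : Type*} {mΩ : MeasurableSpace Ω} {mΩ' : MeasurableSpace Ω'}
    {mα : MeasurableSpace α} {mβ : MeasurableSpace β} {μ : Measure Ω} [IsFiniteMeasure μ]
    {I : Ω → Ω'} (hI : Measurable I) {X : Ω' → α} (hX : Measurable X) {W : Ω → β}
    {κ : Kernel α β} [IsMarkovKernel κ] (hW : Measurable W)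
    (hκ : ∀ A : Set Ω', MeasurableSet A → ∀ f : α × β → ℝ≥0∞, Measurable f →
      ∫⁻ ω in I ⁻¹' A, f (X (I ω), W ω) ∂μ =
        ∫⁻ ω in I ⁻¹' A, ∫⁻ w, f (X (I ω), w) ∂κ (X (I ω)) ∂μ)
    {F : α × β → ℝ} (hF : Measurable F) {Y : Ω → ℝ}
    (hY : Y =ᵐ[μ] fun ω => F (X (I ω), W ω)) :
    ∀ᵐ ω ∂μ, condDistrib Y I μ (I ω) = (κ (X (I ω))).map (fun w => F (X (I ω), w)) := by
  have hm : Measurable fun ω => F (X (I ω), W ω) :=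
    hF.comp ((hX.comp hI).prodMk hW)
  have hYm : AEMeasurable Y μ := hm.aemeasurable.congr hY.symm
  let κ' : Kernel Ω' ℝ := ((Kernel.id ×ₖ κ).map F).comap X hX
  have hκ' : ∀ a, κ' a = (κ (X a)).map (fun w => F (X a, w)) := by
    intro a
    simp only [κ', Kernel.comap_apply, Kernel.map_apply _ hF]
    rw [Kernel.prod_apply, Kernel.id_apply, Measure.dirac_prod, Measure.map_map hF (by fun_prop)]
    rfl
  have : IsMarkovKernel κ' := by
    have : IsMarkovKernel ((Kernel.id ×ₖ κ).map F) := Kernel.IsMarkovKernel.map _ hF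
    infer_instance
  have main : μ.map (fun ω => (I ω, Y ω)) = μ.map I ⊗ₘ κ' := by
    refine Measure.ext_prod fun {A B} hA hB => ?_
    rw [Measure.compProd_apply_prod hA hB, setLIntegral_map hA (Kernel.measurable_coe _ hB) hI,
      Measure.map_apply_of_aemeasurable (hI.aemeasurable.prodMk hYm) (hA.prod hB)]
    have h1 : μ ((fun ω => (I ω, Y ω)) ⁻¹' A ×ˢ B)
        = ∫⁻ ω in I ⁻¹' A, (F ⁻¹' B).indicator 1 (X (I ω), W ω) ∂μ := by
      have : ∀ ω, (F ⁻¹' B).indicator (1 : α × β → ℝ≥0∞) (X (I ω), W ω)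
          = ((fun ω => F (X (I ω), W ω)) ⁻¹' B).indicator 1 ω := fun ω => rfl
      simp_rw [this]
      rw [lintegral_indicator_one (hm hB), Measure.restrict_apply (hm hB)]
      refine measure_congr ?_
      filter_upwards [hY] with ω hω
      simp only [Set.preimage, Set.mem_prod, eq_iff_iff]
      change (I ω ∈ A ∧ Y ω ∈ B) ↔ (F (X (I ω), W ω) ∈ B ∧ I ω ∈ A)
      rw [hω, and_comm]
    rw [h1, hκ A hA _ (measurable_one.indicator (hF hB))]
    refine lintegral_congr fun ω => ?_
    have hs : Measurable fun w => F (X (I ω), w) := hF.comp measurable_prodMk_left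
    rw [hκ', Measure.map_apply hs hB, ← lintegral_indicator_one (hs hB)]
    rfl
  have := condDistrib_ae_eq_of_measure_eq_compProd I hYm main
  filter_upwards [ae_of_ae_map hI.aemeasurable this] with ω hω
  rw [hω, hκ']

/-- `κ (X ω)` is the conditional law of `W` given the σ-algebra `m`, where `X` is `m`-measurable. -/
def HasCondKernel {Ω α β : Type*} [MeasurableSpace α] [MeasurableSpace β] (m : MeasurableSpace Ω)
    {mΩ : MeasurableSpace Ω} (μ : Measure Ω) (X : Ω → α) (W : Ω → β) (κ : Kernel α β) : Prop :=
  ∀ A : Set Ω, MeasurableSet[m] A → ∀ f : α × β → ℝ≥0∞, Measurable f →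
      ∫⁻ ω in A, f (X ω, W ω) ∂μ = ∫⁻ ω in A, ∫⁻ w, f (X ω, w) ∂κ (X ω) ∂μ

lemma HasCondKernel.condLaw_ae_eq {Ω α β : Type*} {m mΩ : MeasurableSpace Ω}
    [mα : MeasurableSpace α] [mβ : MeasurableSpace β]
    {μ : Measure Ω} [IsFiniteMeasure μ] (hm : m ≤ mΩ)
    {X : Ω → α} (hX : Measurable[m] X) {W : Ω → β} (hW : Measurable W)
    {κ : Kernel α β} [IsMarkovKernel κ] (hκ : HasCondKernel m μ X W κ)
    {F : α × β → ℝ} (hF : Measurable F) {Y : Ω → ℝ} (hY : Y =ᵐ[μ] fun ω => F (X ω, W ω)) :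
    ∀ᵐ ω ∂μ, condLaw μ m Y ω = (κ (X ω)).map (fun w => F (X ω, w)) :=
  @condDistrib_ae_eq_map Ω Ω α β mΩ m mα mβ μ _ id (measurable_id'' hm) X hX W κ _ hW
    (fun A hA f hf => hκ A hA f hf) F hF Y hY

lemma hasCondKernel_of_indep {Ω α : Type*} {m mΩ : MeasurableSpace Ω} [mα : MeasurableSpace α]
    {μ : Measure Ω} [IsProbabilityMeasure μ] (hm : m ≤ mΩ) {X : Ω → α} (hX : Measurable[m] X)
    {W : Ω → ℝ} (hW : Measurable W) {ν : Measure ℝ} [IsProbabilityMeasure ν] (hν : μ.map W = ν)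
    (hind : Indep (MeasurableSpace.comap W inferInstance) m μ) :
    HasCondKernel m μ X W (Kernel.const α ν) := by
  intro A hA f hf
  let X' : Ω → α × Prop := fun ω => (X ω, ω ∈ A)
  have hX'm : Measurable[m] X' := hX.prodMk ((@measurable_mem Ω A m).2 hA)
  have hX' : Measurable X' := hX'm.mono hm le_rfl
  have hi : IndepFun X' W μ := by
    rw [IndepFun_iff_Indep]
    exact (indep_of_indep_of_le_right hind hX'm.comap_le).symm
  have hmap := (indepFun_iff_map_prod_eq_prod_map_map hX'.aemeasurable hW.aemeasurable).1 hi
  rw [hν] at hmap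
  classical
  let g : (α × Prop) × ℝ → ℝ≥0∞ := fun q => if q.1.2 then f (q.1.1, q.2) else 0
  have hg : Measurable g :=
    Measurable.ite (measurableSet_setOfPred.2 (by fun_prop)) (by fun_prop) (by fun_prop)
  have hA' := hm A hA
  calc ∫⁻ ω in A, f (X ω, W ω) ∂μ = ∫⁻ ω, g (X' ω, W ω) ∂μ := by
        rw [← lintegral_indicator hA']
        refine lintegral_congr fun ω => ?_
        simp [g, X', Set.indicator_apply]
    _ = ∫⁻ q, g q ∂(μ.map fun ω => (X' ω, W ω)) := (lintegral_map hg (hX'.prodMk hW)).symm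
    _ = ∫⁻ x, ∫⁻ w, g (x, w) ∂ν ∂(μ.map X') := by rw [hmap, lintegral_prod _ hg.aemeasurable]
    _ = ∫⁻ ω, ∫⁻ w, g (X' ω, w) ∂ν ∂μ := lintegral_map hg.lintegral_prod_right' hX'
    _ = _ := by
        rw [← lintegral_indicator hA']
        refine lintegral_congr fun ω => ?_
        by_cases h : ω ∈ A <;> simp [g, X', h]

/-! ### The pricing kernel as an exponential tilt -/

section PricingKernel

variable {Ω : Type*} {mΩ : MeasurableSpace Ω} {P : Measure Ω} {𝒢 : Filtration ℕ mΩ} {p : Params}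
  {S h z φ ξ : ℕ → Ω → ℝ}

namespace IsHestonNandi

lemma measurable_shock (hHN : IsHestonNandi P 𝒢 p S h z) (t : ℕ) : Measurable (z (t + 1)) :=
  (hHN.shock_adapted t).mono (𝒢.le _) le_rfl

lemma measurable_logReturn (hHN : IsHestonNandi P 𝒢 p S h z) (t : ℕ) :
    Measurable[𝒢 (t + 1)] (logReturn S t) :=
  ((hHN.price_adapted (t + 1)).div
    ((hHN.price_adapted t).mono (𝒢.mono t.le_succ) le_rfl)).log

lemma measurable_cumReturn (hHN : IsHestonNandi P 𝒢 p S h z) (t k : ℕ) :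
    Measurable[𝒢 (t + k)] (cumReturn S t k) := by
  refine Finset.measurable_fun_sum _ fun i hi => ?_
  have := Finset.mem_range.1 hi
  exact (hHN.measurable_logReturn (t + i)).mono (𝒢.mono (by omega)) le_rfl

lemma hasCondKernel_shock [IsProbabilityMeasure P] (hHN : IsHestonNandi P 𝒢 p S h z) (t : ℕ)
    {α : Type*} [MeasurableSpace α] {X : Ω → α} (hX : Measurable[𝒢 t] X) :
    HasCondKernel (𝒢 t) P X (z (t + 1)) (Kernel.const α (gaussianReal 0 1)) :=
  hasCondKernel_of_indep (𝒢.le t) hX (hHN.measurable_shock t) (hHN.shock_law t)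
    (hHN.shock_indep t)

/-- The conditional variances stay positive, since the shock a.s. avoids the one value at which
the squared innovation vanishes. -/
lemma variance_pos [IsProbabilityMeasure P] (hHN : IsHestonNandi P 𝒢 p S h z) (hα : 0 < p.alpha)
    (hβ : 0 ≤ p.beta) (hω : 0 ≤ p.omega) (t : ℕ) : ∀ᵐ ω ∂P, 0 < h (t + 1) ω := by
  induction t with
  | zero => exact hHN.initial_variance_pos
  | succ t ih =>
    have hne : ∀ᵐ ω ∂P, z (t + 1) ω ≠ p.gamma * Real.sqrt (h (t + 1) ω) := by
      have hX : Measurable[𝒢 t] fun ω => p.gamma * Real.sqrt (h (t + 1) ω) :=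
        ((hHN.variance_predictable t).sqrt).const_mul _
      have hs : MeasurableSet {q : ℝ × ℝ | q.2 = q.1} :=
        measurableSet_eq_fun measurable_snd measurable_fst
      have := hHN.hasCondKernel_shock t hX Set.univ MeasurableSet.univ
        ({q : ℝ × ℝ | q.2 = q.1}.indicator 1) (measurable_one.indicator hs)
      have h0 : ∀ x : ℝ, ∫⁻ w, {q : ℝ × ℝ | q.2 = q.1}.indicator (1 : ℝ × ℝ → ℝ≥0∞) (x, w)
          ∂(gaussianReal 0 1) = 0 := by
        intro x
        have e : ∀ w, {q : ℝ × ℝ | q.2 = q.1}.indicator (1 : ℝ × ℝ → ℝ≥0∞) (x, w)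
            = ({x} : Set ℝ).indicator 1 w := fun w => by
          simp [Set.indicator_apply]
        simp_rw [e]
        rw [lintegral_indicator_one (measurableSet_singleton x)]
        have := nullSingletonClass_gaussianReal (μ := 0) (v := 1) one_ne_zero
        exact measure_singleton x
      simp only [Kernel.const_apply, h0, lintegral_zero, Measure.restrict_univ] at this
      have hm : Measurable fun ω => {q : ℝ × ℝ | q.2 = q.1}.indicator (1 : ℝ × ℝ → ℝ≥0∞)
          (p.gamma * Real.sqrt (h (t + 1) ω), z (t + 1) ω) :=
        (measurable_one.indicator hs).comp
          ((hX.mono (𝒢.le t) le_rfl).prodMk (hHN.measurable_shock t))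
      rw [lintegral_eq_zero_iff hm] at this
      filter_upwards [this] with ω hω
      intro hc
      simp [hc] at hω
    filter_upwards [ih, hne, hHN.variance_eq t] with ω h1 h2 h3
    rw [h3]
    have : 0 < (z (t + 1) ω - p.gamma * Real.sqrt (h (t + 1) ω)) ^ 2 :=
      sq_pos_of_ne_zero (sub_ne_zero.2 h2)
    have := mul_pos hα this
    have := mul_nonneg hβ h1.le
    linarith

end IsHestonNandi

/-- Coefficients `(b, c, d)` for which the numerator of the pricing kernel is
`exp (b z ^ 2 + c z + d)`, with `z` the shock of the period. -/
noncomputable def tiltCoeff (p : Params) (h φ ξ : ℕ → Ω → ℝ) (t : ℕ) (ω : Ω) : ℝ × ℝ × ℝ :=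
  (p.alpha * ξ t ω,
    (φ t ω - 2 * p.alpha * p.gamma * ξ t ω) * Real.sqrt (h (t + 1) ω),
    φ t ω * (p.r + (p.lam - 1 / 2) * h (t + 1) ω)
      + ξ t ω * (p.omega + p.beta * h (t + 1) ω + p.alpha * p.gamma ^ 2 * h (t + 1) ω))

/-- The exponential `exp (b y ^ 2 + c y + d)`. -/
noncomputable def expQuad (q : ℝ × ℝ × ℝ) (y : ℝ) : ℝ := Real.exp (q.1 * y ^ 2 + q.2.1 * y + q.2.2)

lemma measurable_expQuad : Measurable fun q : (ℝ × ℝ × ℝ) × ℝ => expQuad q.1 q.2 := by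
  unfold expQuad; fun_prop

lemma measurable_integral_expQuad :
    Measurable fun q : ℝ × ℝ × ℝ => ∫ y, expQuad q y ∂(gaussianReal 0 1) :=
  (measurable_expQuad.stronglyMeasurable.integral_prod_right
    (f := fun q y => expQuad q y)).measurable

lemma measurable_varianceRiskRatio [IsFiniteMeasure P] (hM : IsPricingKernel P 𝒢 p S h φ ξ)
    (u : ℕ) : Measurable[𝒢 u] (varianceRiskRatio p ξ u) :=
  (((hM.xi_adapted u).const_mul (2 * p.alpha)).const_sub 1).inv

lemma measurable_tiltCoeff [IsFiniteMeasure P] (hHN : IsHestonNandi P 𝒢 p S h z)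
    (hM : IsPricingKernel P 𝒢 p S h φ ξ) (t : ℕ) :
    Measurable[𝒢 t] (tiltCoeff p h φ ξ t) := by
  have h1 := hHN.variance_predictable t
  have h2 := hM.phi_adapted t
  have h3 := hM.xi_adapted t
  have h4 := h1.sqrt
  unfold tiltCoeff
  refine Measurable.prodMk (h3.const_mul _) (Measurable.prodMk ?_ ?_)
  · exact (h2.sub (h3.const_mul _)).mul h4
  · exact (h2.mul ((h1.const_mul _).const_add _)).add
      (h3.mul (((h1.const_mul _).const_add _).add (h1.const_mul _)))

variable [IsProbabilityMeasure P]

lemma kernelNumerator_ae_eq (hHN : IsHestonNandi P 𝒢 p S h z) (hα : 0 < p.alpha)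
    (hβ : 0 ≤ p.beta) (hω : 0 ≤ p.omega) (φ ξ : ℕ → Ω → ℝ) (t : ℕ) :
    kernelNumerator S h φ ξ t =ᵐ[P] fun ω => expQuad (tiltCoeff p h φ ξ t ω) (z (t + 1) ω) := by
  filter_upwards [hHN.variance_pos hα hβ hω t, hHN.return_eq t, hHN.variance_eq t] with ω h1 h2 h3
  have hs := Real.sq_sqrt h1.le
  simp only [kernelNumerator, expQuad, tiltCoeff, h2, h3]
  congr 1
  linear_combination (ξ t ω * p.alpha * p.gamma ^ 2) * hs

/-- Finiteness of the conditional mean of the numerator forces `2 α ξ < 1`, and then identifies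
the conditional mean as a Gaussian integral. -/
lemma condMean_kernelNumerator (hHN : IsHestonNandi P 𝒢 p S h z)
    (hM : IsPricingKernel P 𝒢 p S h φ ξ) (hα : 0 < p.alpha)
    (hβ : 0 ≤ p.beta) (hω : 0 ≤ p.omega) (t : ℕ) :
    ∀ᵐ ω ∂P, p.alpha * ξ t ω < 1 / 2 ∧ condMean P (𝒢 t) (kernelNumerator S h φ ξ t) ω =
      ∫ y, expQuad (tiltCoeff p h φ ξ t ω) y ∂(gaussianReal 0 1) := by
  have hX := measurable_tiltCoeff hHN hM t
  have := (hHN.hasCondKernel_shock t hX).condLaw_ae_eq (𝒢.le t) hX (hHN.measurable_shock t)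
    measurable_expQuad (kernelNumerator_ae_eq hHN hα hβ hω φ ξ t)
  filter_upwards [this, hM.finite_condMean t] with ω h1 h2
  have hm : Measurable fun y => expQuad (tiltCoeff p h φ ξ t ω) y :=
    measurable_expQuad.comp measurable_prodMk_left
  simp only [Kernel.const_apply] at h1
  constructor
  · rw [h1, integrable_map_measure (by fun_prop) hm.aemeasurable] at h2
    exact lt_half_of_integrable_exp_quadratic h2
  · rw [condMean, h1, integral_map hm.aemeasurable (by fun_prop)]

lemma pricingKernel_ae_eq (hHN : IsHestonNandi P 𝒢 p S h z)
    (hM : IsPricingKernel P 𝒢 p S h φ ξ) (hα : 0 < p.alpha)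
    (hβ : 0 ≤ p.beta) (hω : 0 ≤ p.omega) (t : ℕ) :
    pricingKernel P 𝒢 S h φ ξ t =ᵐ[P] fun ω => expQuad (tiltCoeff p h φ ξ t ω) (z (t + 1) ω) /
      ∫ y, expQuad (tiltCoeff p h φ ξ t ω) y ∂(gaussianReal 0 1) := by
  filter_upwards [kernelNumerator_ae_eq hHN hα hβ hω φ ξ t,
    condMean_kernelNumerator hHN hM hα hβ hω t] with ω h1 h2
  rw [pricingKernel, h1, h2.2]

lemma varianceRiskRatio_pos (hHN : IsHestonNandi P 𝒢 p S h z)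
    (hM : IsPricingKernel P 𝒢 p S h φ ξ) (hα : 0 < p.alpha)
    (hβ : 0 ≤ p.beta) (hω : 0 ≤ p.omega) (t : ℕ) :
    ∀ᵐ ω ∂P, 0 < varianceRiskRatio p ξ t ω := by
  filter_upwards [condMean_kernelNumerator hHN hM hα hβ hω t] with ω h1
  rw [varianceRiskRatio, inv_pos]
  linarith [h1.1]

/-- Mean of the shock `z_{t+1}` under the risk-neutral measure, given the past, when `v` is the
current conditional variance and `e` the variance risk ratio. -/
noncomputable def tiltedMean (p : Params) (v e : ℝ) : ℝ :=
  -(Real.sqrt v * (p.lam - 1 / 2 + e / 2))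

/-- Absence of arbitrage pins down the mean of the tilted normal law of the shock. -/
lemma tilt_mean_eq (hHN : IsHestonNandi P 𝒢 p S h z)
    (hM : IsPricingKernel P 𝒢 p S h φ ξ) (hα : 0 < p.alpha)
    (hβ : 0 ≤ p.beta) (hω : 0 ≤ p.omega) (t : ℕ) :
    ∀ᵐ ω ∂P, (tiltCoeff p h φ ξ t ω).2.1 * varianceRiskRatio p ξ t ω =
      tiltedMean p (h (t + 1) ω) (varianceRiskRatio p ξ t ω) := by
  let F : ((ℝ × ℝ × ℝ) × ℝ) × ℝ → ℝ := fun q =>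
    expQuad q.1.1 q.2 / (∫ y, expQuad q.1.1 y ∂(gaussianReal 0 1)) *
      Real.exp (p.r + (p.lam - 1 / 2) * q.1.2 + Real.sqrt q.1.2 * q.2)
  have hF : Measurable F := by
    refine Measurable.mul (Measurable.div ?_ ?_) (by fun_prop)
    · exact measurable_expQuad.comp ((measurable_fst.comp measurable_fst).prodMk measurable_snd)
    · exact measurable_integral_expQuad.comp (measurable_fst.comp measurable_fst)
  have hX : Measurable[𝒢 t] fun ω => (tiltCoeff p h φ ξ t ω, h (t + 1) ω) :=
    (measurable_tiltCoeff hHN hM t).prodMk (hHN.variance_predictable t)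
  have hY : (fun ω => pricingKernel P 𝒢 S h φ ξ t ω * Real.exp (logReturn S t ω)) =ᵐ[P]
      fun ω => F ((tiltCoeff p h φ ξ t ω, h (t + 1) ω), z (t + 1) ω) := by
    filter_upwards [pricingKernel_ae_eq hHN hM hα hβ hω t, hHN.return_eq t] with ω h1 h2
    simp only [F, h1, h2]
  have := (hHN.hasCondKernel_shock t hX).condLaw_ae_eq (𝒢.le t) hX (hHN.measurable_shock t)
    hF hY
  filter_upwards [this, hM.no_arbitrage t, condMean_kernelNumerator hHN hM hα hβ hω t,
    hHN.variance_pos hα hβ hω t, varianceRiskRatio_pos hHN hM hα hβ hω t] with ω h1 h2 h3 h4 h5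
  set q := tiltCoeff p h φ ξ t ω with hq
  set v := h (t + 1) ω with hv
  set e := varianceRiskRatio p ξ t ω with he
  have hq1 : q.1 < 1 / 2 := h3.1
  have hqe : (1 - 2 * q.1)⁻¹ = e := by rw [he, varianceRiskRatio, hq, tiltCoeff]; ring_nf
  have hm : Measurable fun y => F ((q, v), y) := hF.comp measurable_prodMk_left
  simp only [Kernel.const_apply] at h1
  rw [condMean, h1, integral_map hm.aemeasurable (by fun_prop)] at h2
  have hpos : 0 ≤ ∫ y, expQuad q y ∂(gaussianReal 0 1) :=
    integral_nonneg fun y => (Real.exp_pos _).le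
  have hF0 : ∀ y, 0 ≤ F ((q, v), y) := fun y =>
    mul_nonneg (div_nonneg (Real.exp_pos _).le hpos) (Real.exp_pos _).le
  rw [integral_eq_lintegral_of_nonneg_ae (ae_of_all _ hF0) hm.aestronglyMeasurable] at h2
  have h6 : ∫⁻ y, ENNReal.ofReal (F ((q, v), y)) ∂(gaussianReal 0 1) =
      ∫⁻ y, ENNReal.ofReal (Real.exp (p.r + (p.lam - 1 / 2) * v + Real.sqrt v *
        (q.2.1 * e + Real.sqrt e * y))) ∂(gaussianReal 0 1) := by
    have := lintegral_tilted_gaussian hq1 q.2.1 q.2.2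
      (f := fun y => ENNReal.ofReal (Real.exp (p.r + (p.lam - 1 / 2) * v + Real.sqrt v * y)))
      (by fun_prop)
    rw [hqe] at this
    rw [← this]
    refine lintegral_congr fun y => ?_
    exact ENNReal.ofReal_mul (div_nonneg (Real.exp_pos _).le hpos)
  rw [h6, ← integral_eq_lintegral_of_nonneg_ae (ae_of_all _ fun y => (Real.exp_pos _).le)
    (by fun_prop)] at h2
  have h7 : ∀ y, Real.exp (p.r + (p.lam - 1 / 2) * v + Real.sqrt v * (q.2.1 * e + Real.sqrt e * y))
      = Real.exp (p.r + (p.lam - 1 / 2) * v + Real.sqrt v * (q.2.1 * e)) *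
        Real.exp (Real.sqrt v * Real.sqrt e * y) := by
    intro y; rw [← Real.exp_add]; congr 1; ring
  simp_rw [h7] at h2
  have h8 : ∫ y, Real.exp (Real.sqrt v * Real.sqrt e * y) ∂(gaussianReal 0 1)
      = Real.exp (v * e / 2) := by
    have := congrFun (mgf_fun_id_gaussianReal (μ := 0) (v := 1)) (Real.sqrt v * Real.sqrt e)
    rw [mgf] at this
    rw [this]
    congr 1
    rw [mul_pow, Real.sq_sqrt h4.le, Real.sq_sqrt h5.le]
    simp
  rw [integral_const_mul, h8, ← Real.exp_add] at h2
  have h9 := Real.exp_injective h2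
  have hs := Real.sq_sqrt h4.le
  have hs0 : Real.sqrt v ≠ 0 := (Real.sqrt_pos.2 h4).ne'
  rw [tiltedMean]
  apply mul_left_cancel₀ hs0
  linear_combination h9 + (p.lam - 1 / 2 + e / 2) * hs

/-- Integrating a function of the shock against the pricing kernel amounts to replacing the
standard normal law of the shock by its risk-neutral law. -/
lemma lintegral_pricingKernel_mul (hHN : IsHestonNandi P 𝒢 p S h z)
    (hM : IsPricingKernel P 𝒢 p S h φ ξ) (hα : 0 < p.alpha)
    (hβ : 0 ≤ p.beta) (hω : 0 ≤ p.omega) (t : ℕ) {α : Type*} [MeasurableSpace α] {X : Ω → α}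
    (hX : Measurable[𝒢 t] X) {f : α × ℝ → ℝ≥0∞} (hf : Measurable f) :
    ∫⁻ ω, ENNReal.ofReal (pricingKernel P 𝒢 S h φ ξ t ω) * f (X ω, z (t + 1) ω) ∂P =
      ∫⁻ ω, ∫⁻ y, f (X ω, tiltedMean p (h (t + 1) ω) (varianceRiskRatio p ξ t ω) +
        Real.sqrt (varianceRiskRatio p ξ t ω) * y) ∂(gaussianReal 0 1) ∂P := by
  let F : ((ℝ × ℝ × ℝ) × α) × ℝ → ℝ≥0∞ := fun q =>
    ENNReal.ofReal (expQuad q.1.1 q.2 / (∫ y, expQuad q.1.1 y ∂(gaussianReal 0 1))) *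
      f (q.1.2, q.2)
  have hF : Measurable F := by
    refine Measurable.mul (Measurable.ennreal_ofReal (Measurable.div ?_ ?_))
      (hf.comp (by fun_prop))
    · exact measurable_expQuad.comp ((measurable_fst.comp measurable_fst).prodMk measurable_snd)
    · exact measurable_integral_expQuad.comp (measurable_fst.comp measurable_fst)
  have hX' : Measurable[𝒢 t] fun ω => (tiltCoeff p h φ ξ t ω, X ω) :=
    (measurable_tiltCoeff hHN hM t).prodMk hX
  have key := hHN.hasCondKernel_shock t hX' Set.univ MeasurableSet.univ F hF
  simp only [Measure.restrict_univ, Kernel.const_apply] at key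
  calc _ = ∫⁻ ω, F ((tiltCoeff p h φ ξ t ω, X ω), z (t + 1) ω) ∂P := by
        refine lintegral_congr_ae ?_
        filter_upwards [pricingKernel_ae_eq hHN hM hα hβ hω t] with ω h1
        rw [h1]
    _ = _ := key
    _ = _ := by
        refine lintegral_congr_ae ?_
        filter_upwards [condMean_kernelNumerator hHN hM hα hβ hω t,
          tilt_mean_eq hHN hM hα hβ hω t] with ω h3 h4
        set q := tiltCoeff p h φ ξ t ω with hq
        have hqe : (1 - 2 * q.1)⁻¹ = varianceRiskRatio p ξ t ω := by
          rw [varianceRiskRatio, hq, tiltCoeff]; ring_nf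
        have := lintegral_tilted_gaussian (b := q.1) h3.1 q.2.1 q.2.2
          (f := fun y => f (X ω, y)) (by fun_prop)
        rw [hqe, h4] at this
        exact this

end PricingKernel

/-! ### The dynamics under the risk-neutral measure -/

section RiskNeutral

variable {Ω : Type*} {mΩ : MeasurableSpace Ω} {P Q : Measure Ω} [IsProbabilityMeasure P]
  {𝒢 : Filtration ℕ mΩ} {p : Params} {S h z φ ξ : ℕ → Ω → ℝ}

/-- The density of the risk-neutral measure on `𝒢 u`, in the explicit form given by
`pricingKernel_ae_eq`; unlike the product of the pricing kernels, which is defined by means of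
versions of conditional laws, it is visibly `𝒢 u`-measurable. -/
noncomputable def tiltDensity (p : Params) (h z φ ξ : ℕ → Ω → ℝ) (u : ℕ) (ω : Ω) : ℝ≥0∞ :=
  ∏ j ∈ Finset.range u, ENNReal.ofReal (expQuad (tiltCoeff p h φ ξ j ω) (z (j + 1) ω) /
      ∫ y, expQuad (tiltCoeff p h φ ξ j ω) y ∂(gaussianReal 0 1))

lemma measurable_tiltDensity (hHN : IsHestonNandi P 𝒢 p S h z)
    (hM : IsPricingKernel P 𝒢 p S h φ ξ) (u : ℕ) :
    Measurable[𝒢 u] (tiltDensity p h z φ ξ u) := by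
  refine Finset.measurable_prod _ fun j hj => ?_
  have hj := Finset.mem_range.1 hj
  have h1 : Measurable[𝒢 u] (tiltCoeff p h φ ξ j) :=
    (measurable_tiltCoeff hHN hM j).mono (𝒢.mono hj.le) le_rfl
  have h2 : Measurable[𝒢 u] (z (j + 1)) := (hHN.shock_adapted j).mono (𝒢.mono hj) le_rfl
  exact ((measurable_expQuad.comp (h1.prodMk h2)).div
    (measurable_integral_expQuad.comp h1)).ennreal_ofReal

lemma tiltDensity_succ_ae (hHN : IsHestonNandi P 𝒢 p S h z)
    (hM : IsPricingKernel P 𝒢 p S h φ ξ) (hα : 0 < p.alpha)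
    (hβ : 0 ≤ p.beta) (hω : 0 ≤ p.omega) (u : ℕ) :
    ∀ᵐ ω ∂P, tiltDensity p h z φ ξ (u + 1) ω =
      ENNReal.ofReal (pricingKernel P 𝒢 S h φ ξ u ω) * tiltDensity p h z φ ξ u ω := by
  filter_upwards [pricingKernel_ae_eq hHN hM hα hβ hω u] with ω h1
  rw [h1, tiltDensity, Finset.prod_range_succ, mul_comm]
  rfl

lemma prod_pricingKernel_ae_eq (hHN : IsHestonNandi P 𝒢 p S h z)
    (hM : IsPricingKernel P 𝒢 p S h φ ξ) (hα : 0 < p.alpha)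
    (hβ : 0 ≤ p.beta) (hω : 0 ≤ p.omega) (T : ℕ) :
    ∀ᵐ ω ∂P, ENNReal.ofReal (∏ j ∈ Finset.range T, pricingKernel P 𝒢 S h φ ξ j ω) =
      tiltDensity p h z φ ξ T ω := by
  have : ∀ᵐ ω ∂P, ∀ j, pricingKernel P 𝒢 S h φ ξ j ω =
      expQuad (tiltCoeff p h φ ξ j ω) (z (j + 1) ω) /
        ∫ y, expQuad (tiltCoeff p h φ ξ j ω) y ∂(gaussianReal 0 1) :=
    ae_all_iff.2 fun j => pricingKernel_ae_eq hHN hM hα hβ hω j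
  filter_upwards [this] with ω h1
  simp_rw [h1]
  rw [tiltDensity, ENNReal.ofReal_prod_of_nonneg]
  exact fun j _ => div_nonneg (Real.exp_pos _).le (integral_nonneg fun y => (Real.exp_pos _).le)

/-- `Q` is only prescribed on `𝒢 T`, so that `P`-null sets are `Q`-null only within `𝒢 T`. -/
lemma IsRiskNeutral.ae_mem {T : ℕ} (hQ : IsRiskNeutral P Q 𝒢 S h φ ξ T)
    {s : Set Ω} (hs : MeasurableSet[𝒢 T] s) (h : ∀ᵐ ω ∂P, ω ∈ s) : ∀ᵐ ω ∂Q, ω ∈ s := by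
  have h0 : P sᶜ = 0 := h
  have : Q sᶜ = 0 := by
    rw [hQ _ hs.compl, Measure.restrict_eq_zero.2 h0, lintegral_zero_measure]
  exact this

/-- The density of `Q` on each earlier σ-algebra is the partial product, the pricing kernels having
conditional mean one. -/
lemma IsRiskNeutral.lintegral_eq {T : ℕ} (hQ : IsRiskNeutral P Q 𝒢 S h φ ξ T)
    (hHN : IsHestonNandi P 𝒢 p S h z)
    (hM : IsPricingKernel P 𝒢 p S h φ ξ) (hα : 0 < p.alpha)
    (hβ : 0 ≤ p.beta) (hω : 0 ≤ p.omega) {u : ℕ} (hu : u ≤ T) :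
    ∀ {g : Ω → ℝ≥0∞}, Measurable[𝒢 u] g →
      ∫⁻ ω, g ω ∂Q = ∫⁻ ω, tiltDensity p h z φ ξ u ω * g ω ∂P := by
  induction hu using Nat.decreasingInduction with
  | self =>
    intro g hg
    have hD := measurable_tiltDensity hHN hM T
    have htrim : Q.trim (𝒢.le T) = (P.withDensity (tiltDensity p h z φ ξ T)).trim (𝒢.le T) := by
      refine @Measure.ext _ (𝒢 T) _ _ fun A hA => ?_
      rw [trim_measurableSet_eq _ hA, trim_measurableSet_eq _ hA, hQ A hA,
        withDensity_apply _ (𝒢.le T A hA)]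
      exact lintegral_congr_ae (ae_restrict_of_ae
        (prod_pricingKernel_ae_eq hHN hM hα hβ hω T))
    rw [← lintegral_trim (𝒢.le T) hg, htrim, lintegral_trim (𝒢.le T) hg,
      lintegral_withDensity_eq_lintegral_mul _ (hD.mono (𝒢.le T) le_rfl)
        (hg.mono (𝒢.le T) le_rfl)]
    rfl
  | of_succ u hu ih =>
    intro g hg
    rw [ih (hg.mono (𝒢.mono u.le_succ) le_rfl)]
    have hX : Measurable[𝒢 u] fun ω => tiltDensity p h z φ ξ u ω * g ω :=
      (measurable_tiltDensity hHN hM u).mul hg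
    have := lintegral_pricingKernel_mul hHN hM hα hβ hω u hX (f := fun q => q.1) measurable_fst
    simp only [lintegral_const, measure_univ, mul_one] at this
    rw [← this]
    refine lintegral_congr_ae ?_
    filter_upwards [tiltDensity_succ_ae hHN hM hα hβ hω u] with ω h1
    rw [h1, mul_assoc]

/-- Given the past, the shock is normal under the risk-neutral measure. -/
lemma IsRiskNeutral.lintegral_shock {T : ℕ} (hQ : IsRiskNeutral P Q 𝒢 S h φ ξ T)
    (hHN : IsHestonNandi P 𝒢 p S h z)
    (hM : IsPricingKernel P 𝒢 p S h φ ξ) (hα : 0 < p.alpha)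
    (hβ : 0 ≤ p.beta) (hω : 0 ≤ p.omega) {u : ℕ} (hu : u < T) {α : Type*} [MeasurableSpace α]
    {X : Ω → α} (hX : Measurable[𝒢 u] X) {f : α × ℝ → ℝ≥0∞} (hf : Measurable f) :
    ∫⁻ ω, f (X ω, z (u + 1) ω) ∂Q =
      ∫⁻ ω, ∫⁻ y, f (X ω, tiltedMean p (h (u + 1) ω) (varianceRiskRatio p ξ u ω) +
        Real.sqrt (varianceRiskRatio p ξ u ω) * y) ∂(gaussianReal 0 1) ∂Q := by
  have hD := measurable_tiltDensity hHN hM u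
  have h1 : Measurable[𝒢 (u + 1)] fun ω => f (X ω, z (u + 1) ω) :=
    hf.comp ((hX.mono (𝒢.mono u.le_succ) le_rfl).prodMk (hHN.shock_adapted u))
  have hη : Measurable[𝒢 u] (varianceRiskRatio p ξ u) := measurable_varianceRiskRatio hM u
  have hv := hHN.variance_predictable u
  let F : (α × ℝ × ℝ) × ℝ → ℝ≥0∞ := fun q => f (q.1.1, tiltedMean p q.1.2.1 q.1.2.2 +
    Real.sqrt q.1.2.2 * q.2)
  have hF : Measurable F := by
    refine hf.comp (Measurable.prodMk (by fun_prop) ?_)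
    unfold tiltedMean; fun_prop
  have h2 : Measurable[𝒢 u] fun ω => ∫⁻ y, F ((X ω, h (u + 1) ω, varianceRiskRatio p ξ u ω), y)
      ∂(gaussianReal 0 1) :=
    hF.lintegral_prod_right'.comp (hX.prodMk (hv.prodMk hη))
  rw [hQ.lintegral_eq hHN hM hα hβ hω hu h1]
  refine Eq.trans ?_ (hQ.lintegral_eq hHN hM hα hβ hω hu.le h2).symm
  have h3 := lintegral_pricingKernel_mul hHN hM hα hβ hω u (hD.prodMk hX)
    (f := fun q : (ℝ≥0∞ × α) × ℝ => q.1.1 * f (q.1.2, q.2))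
    ((measurable_fst.comp measurable_fst).mul
      (hf.comp ((measurable_snd.comp measurable_fst).prodMk measurable_snd)))
  refine Eq.trans ?_ (h3.trans ?_)
  · refine lintegral_congr_ae ?_
    filter_upwards [tiltDensity_succ_ae hHN hM hα hβ hω u] with ω h1
    rw [h1, mul_assoc]
  · refine lintegral_congr fun ω => ?_
    have hm : Measurable fun y => F ((X ω, h (u + 1) ω, varianceRiskRatio p ξ u ω), y) :=
      hF.comp measurable_prodMk_left
    exact lintegral_const_mul _ hm

end RiskNeutral

/-! ### The risk-neutral Markov chain along a frozen path of the variance risk ratio -/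

/-- A state of the risk-neutral chain: the path of the variance risk ratio, the current
risk-neutral variance `h*` of the next return, and the return accumulated so far. -/
abbrev ChainState : Type := (ℕ → ℝ) × ℝ × ℝ

/-- The state at time `u + 1` from the state at time `u` and a standard normal shock. -/
noncomputable def stepFun (p : Params) (u : ℕ) (q : ChainState × ℝ) : ChainState :=
  (q.1.1,
    omegaStar p q.1.1 (u + 1) + betaStar p q.1.1 (u + 1) * q.1.2.1
      + alphaStar p q.1.1 (u + 1) * (q.2 - gammaStar p q.1.1 u * Real.sqrt q.1.2.1) ^ 2,
    q.1.2.2 + (p.r - q.1.2.1 / 2 + Real.sqrt q.1.2.1 * q.2))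

lemma measurable_stepFun (p : Params) (u : ℕ) : Measurable (stepFun p u) := by
  unfold stepFun omegaStar betaStar alphaStar gammaStar
  fun_prop

/-- The transition kernel of the chain from time `u` to time `u + 1`. -/
noncomputable def stepKernel (p : Params) (u : ℕ) : Kernel ChainState ChainState :=
  (Kernel.id ×ₖ Kernel.const ChainState (gaussianReal 0 1)).map (stepFun p u)

instance (p : Params) (u : ℕ) : IsMarkovKernel (stepKernel p u) :=
  Kernel.IsMarkovKernel.map _ (measurable_stepFun p u)

lemma stepKernel_apply (p : Params) (u : ℕ) (a : ChainState) :
    stepKernel p u a = (gaussianReal 0 1).map fun y => stepFun p u (a, y) := by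
  rw [stepKernel, Kernel.map_apply _ (measurable_stepFun p u), Kernel.prod_apply, Kernel.id_apply,
    Measure.dirac_prod, Kernel.const_apply, Measure.map_map (measurable_stepFun p u) (by fun_prop)]
  rfl

/-- `chain p m u` is the law of the state at time `u + m` given the state at time `u`. -/
noncomputable def chain (p : Params) : ℕ → ℕ → Kernel ChainState ChainState
  | 0, _ => Kernel.id
  | m + 1, u => chain p m (u + 1) ∘ₖ stepKernel p u

instance isMarkovKernel_chain (p : Params) : ∀ m u, IsMarkovKernel (chain p m u)
  | 0, _ => by unfold chain; infer_instance
  | m + 1, u => by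
    have := isMarkovKernel_chain p m (u + 1)
    unfold chain; infer_instance

lemma lintegral_chain_succ (p : Params) (m u : ℕ) (a : ChainState) {f : ChainState → ℝ≥0∞}
    (hf : Measurable f) :
    ∫⁻ w, f w ∂(chain p (m + 1) u a) =
      ∫⁻ y, ∫⁻ w, f w ∂(chain p m (u + 1) (stepFun p u (a, y))) ∂(gaussianReal 0 1) := by
  have hm : Measurable fun y => stepFun p u (a, y) :=
    (measurable_stepFun p u).comp measurable_prodMk_left
  rw [chain, Kernel.lintegral_comp _ _ _ hf, stepKernel_apply,
    lintegral_map hf.lintegral_kernel hm]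

/-- The model's variance and return recursions, rewritten in terms of the risk-neutral variance
`e v` and the standardised shock `y`. -/
lemma stepFun_eq (p : Params) (u : ℕ) (η : ℕ → ℝ) {v : ℝ} (hv : 0 < v) (hη : 0 < η u) (x y : ℝ) :
    (η, η (u + 1) * (p.omega + p.beta * v + p.alpha *
        (tiltedMean p v (η u) + Real.sqrt (η u) * y - p.gamma * Real.sqrt v) ^ 2),
      x + (p.r + (p.lam - 1 / 2) * v + Real.sqrt v *
        (tiltedMean p v (η u) + Real.sqrt (η u) * y)))
      = stepFun p u ((η, η u * v, x), y) := by
  have hs := Real.sq_sqrt hη.le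
  have hsv := Real.sq_sqrt hv.le
  have hs0 : Real.sqrt (η u) ≠ 0 := (Real.sqrt_pos.2 hη).ne'
  simp only [stepFun, omegaStar, betaStar, alphaStar, gammaStar, Nat.add_sub_cancel, tiltedMean]
  rw [Real.sqrt_mul hη.le]
  refine Prod.ext rfl (Prod.ext ?_ ?_)
  · have h1 : y - (1 / η u * (p.gamma + p.lam - 1 / 2) + 1 / 2) *
        (Real.sqrt (η u) * Real.sqrt v) =
        (-(Real.sqrt v * (p.lam - 1 / 2 + η u / 2)) + Real.sqrt (η u) * y
          - p.gamma * Real.sqrt v) / Real.sqrt (η u) := by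
      rw [eq_div_iff hs0]
      have h2 : η u ≠ 0 := hη.ne'
      have : (y - (1 / η u * (p.gamma + p.lam - 1 / 2) + 1 / 2) *
        (Real.sqrt (η u) * Real.sqrt v)) * Real.sqrt (η u) =
        y * Real.sqrt (η u) - (1 / η u * (p.gamma + p.lam - 1 / 2) + 1 / 2) * Real.sqrt v *
          Real.sqrt (η u) ^ 2 := by ring
      rw [this, hs]
      field_simp
      ring
    simp only [h1, div_pow, hs]
    have h2 : η u ≠ 0 := hη.ne'
    field_simp
  · simp only
    linear_combination (-(p.lam - 1 / 2 + η u / 2)) * hsv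

/-! ### The conditional law of the chain under the risk-neutral measure -/

section CondLaw

variable {Ω : Type*} {mΩ : MeasurableSpace Ω} {P Q : Measure Ω} [IsProbabilityMeasure P]
  {𝒢 : Filtration ℕ mΩ} {p : Params} {S h z φ ξ : ℕ → Ω → ℝ}

/-- The path of the variance risk ratio between `t` and `t + M`, extended by `1` so that only its
predetermined part matters. -/
noncomputable def riskRatioPath (p : Params) (ξ : ℕ → Ω → ℝ) (t M : ℕ) (ω : Ω) (τ : ℕ) : ℝ :=
  if t ≤ τ ∧ τ ≤ t + M then varianceRiskRatio p ξ τ ω else 1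

/-- The state of the model `k` periods after `t`. -/
noncomputable def modelState (p : Params) (S h ξ : ℕ → Ω → ℝ) (t M k : ℕ) (ω : Ω) : ChainState :=
  (riskRatioPath p ξ t M ω, varianceRiskRatio p ξ (t + k) ω * h (t + k + 1) ω, cumReturn S t k ω)

lemma measurable_riskRatioPath (hM : IsPricingKernel P 𝒢 p S h φ ξ) {t M : ℕ}
    (hη : ∀ τ, t + 1 ≤ τ → τ ≤ t + M → Measurable[𝒢 t] (varianceRiskRatio p ξ τ)) :
    Measurable[𝒢 t] (riskRatioPath p ξ t M) := by
  refine @measurable_pi_lambda _ _ _ (𝒢 t) _ _ fun τ => ?_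
  by_cases hτ : t ≤ τ ∧ τ ≤ t + M
  · simp only [riskRatioPath, if_pos hτ]
    rcases hτ.1.eq_or_lt with h1 | h1
    · subst h1; exact measurable_varianceRiskRatio hM t
    · exact hη τ h1 hτ.2
  · simp only [riskRatioPath, if_neg hτ]
    exact measurable_const

lemma measurable_modelState (hHN : IsHestonNandi P 𝒢 p S h z)
    (hM : IsPricingKernel P 𝒢 p S h φ ξ) {t M : ℕ}
    (hη : ∀ τ, t + 1 ≤ τ → τ ≤ t + M → Measurable[𝒢 t] (varianceRiskRatio p ξ τ)) (k : ℕ) :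
    Measurable[𝒢 (t + k)] (modelState p S h ξ t M k) :=
  ((measurable_riskRatioPath hM hη).mono (𝒢.mono (Nat.le_add_right t k)) le_rfl).prodMk
    (((measurable_varianceRiskRatio hM (t + k)).mul (hHN.variance_predictable (t + k))).prodMk
      (hHN.measurable_cumReturn t k))

variable {t M : ℕ}

/-- One step of the model under the risk-neutral measure is a step of the chain. -/
lemma IsRiskNeutral.lintegral_modelState_succ (hQ : IsRiskNeutral P Q 𝒢 S h φ ξ (t + M))
    (hHN : IsHestonNandi P 𝒢 p S h z)
    (hM : IsPricingKernel P 𝒢 p S h φ ξ) (hα : 0 < p.alpha)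
    (hβ : 0 ≤ p.beta) (hω : 0 ≤ p.omega)
    (hη : ∀ τ, t + 1 ≤ τ → τ ≤ t + M → Measurable[𝒢 t] (varianceRiskRatio p ξ τ))
    {k : ℕ} (hk : k < M) {α : Type*} [MeasurableSpace α]
    {X : Ω → α} (hX : Measurable[𝒢 t] X) {f : α × ChainState → ℝ≥0∞} (hf : Measurable f) :
    ∫⁻ ω, f (X ω, modelState p S h ξ t M (k + 1) ω) ∂Q =
      ∫⁻ ω, ∫⁻ y, f (X ω, stepFun p (t + k) (modelState p S h ξ t M k ω, y))
        ∂(gaussianReal 0 1) ∂Q := by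
  have hkT : t + k < t + M := by omega
  have hle : 𝒢 t ≤ 𝒢 (t + k) := 𝒢.mono (Nat.le_add_right t k)
  let Y : Ω → α × ChainState × ℝ := fun ω =>
    (X ω, modelState p S h ξ t M k ω, h (t + k + 1) ω)
  have hY : Measurable[𝒢 (t + k)] Y := (hX.mono hle le_rfl).prodMk
    ((measurable_modelState hHN hM hη k).prodMk (hHN.variance_predictable (t + k)))
  let Φ : (α × ChainState × ℝ) × ℝ → α × ChainState := fun q =>
    (q.1.1, q.1.2.1.1, q.1.2.1.1 (t + k + 1) * (p.omega + p.beta * q.1.2.2 + p.alpha *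
        (q.2 - p.gamma * Real.sqrt q.1.2.2) ^ 2),
      q.1.2.1.2.2 + (p.r + (p.lam - 1 / 2) * q.1.2.2 + Real.sqrt q.1.2.2 * q.2))
  have hΦ : Measurable Φ := by
    have h1 : Measurable fun q : (α × ChainState × ℝ) × ℝ => q.1.2.1.1 (t + k + 1) := by fun_prop
    fun_prop
  -- all the events below are `𝒢 (t + M)`-measurable, so that they carry over from `P` to `Q`
  have hmono : ∀ u ≤ t + M, 𝒢 u ≤ 𝒢 (t + M) := fun u hu => 𝒢.mono hu
  have mh : Measurable[𝒢 (t + M)] (h (t + k + 1)) :=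
    (hHN.variance_predictable (t + k)).mono (hmono _ (by omega)) le_rfl
  have mh2 : Measurable[𝒢 (t + M)] (h (t + k + 2)) :=
    (hHN.variance_predictable (t + k + 1)).mono (hmono _ (by omega)) le_rfl
  have mz : Measurable[𝒢 (t + M)] (z (t + k + 1)) :=
    (hHN.shock_adapted (t + k)).mono (hmono _ (by omega)) le_rfl
  have mR : Measurable[𝒢 (t + M)] (logReturn S (t + k)) :=
    (hHN.measurable_logReturn (t + k)).mono (hmono _ (by omega)) le_rfl
  have mη : Measurable[𝒢 (t + M)] (varianceRiskRatio p ξ (t + k)) :=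
    (measurable_varianceRiskRatio hM (t + k)).mono (hmono _ (by omega)) le_rfl
  have q1 : ∀ᵐ ω ∂Q, 0 < h (t + k + 1) ω :=
    hQ.ae_mem (mh measurableSet_Ioi)
      (hHN.variance_pos hα hβ hω (t + k))
  have q2 : ∀ᵐ ω ∂Q, 0 < varianceRiskRatio p ξ (t + k) ω :=
    hQ.ae_mem (mη measurableSet_Ioi)
      (varianceRiskRatio_pos hHN hM hα hβ hω (t + k))
  have q3 := hQ.ae_mem (@measurableSet_eq_fun _ _ (𝒢 (t + M)) _ _ _ _ mR
    (((mh.const_mul (p.lam - 1 / 2)).const_add p.r).add (mh.sqrt.mul mz)))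
      (hHN.return_eq (t + k))
  have q4 := hQ.ae_mem (@measurableSet_eq_fun _ _ (𝒢 (t + M)) _ _ _ _ mh2
    (((mh.const_mul p.beta).const_add p.omega).add
      (((mz.sub (mh.sqrt.const_mul p.gamma)).pow_const 2).const_mul p.alpha)))
      (hHN.variance_eq (t + k))
  have hpath : ∀ i ≤ M, ∀ ω, riskRatioPath p ξ t M ω (t + i) = varianceRiskRatio p ξ (t + i) ω := by
    intro i hi ω
    rw [riskRatioPath, if_pos ⟨by omega, by omega⟩]
  calc ∫⁻ ω, f (X ω, modelState p S h ξ t M (k + 1) ω) ∂Q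
      = ∫⁻ ω, f (Φ (Y ω, z (t + k + 1) ω)) ∂Q := by
        refine lintegral_congr_ae ?_
        filter_upwards [q3, q4] with ω h3 h4
        have e1 : modelState p S h ξ t M (k + 1) ω = (Φ (Y ω, z (t + k + 1) ω)).2 := by
          simp only [modelState, Φ, Y]
          refine Prod.ext rfl (Prod.ext ?_ ?_)
          · simp only
            rw [add_assoc t k 1, hpath (k + 1) hk, ← add_assoc t k 1]
            exact congrArg _ h4
          · simp only [cumReturn, Finset.sum_range_succ]
            exact congrArg _ h3
        rw [e1]
    _ = _ := hQ.lintegral_shock hHN hM hα hβ hω hkT hY (hf.comp hΦ)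
    _ = _ := by
        refine lintegral_congr_ae ?_
        filter_upwards [q1, q2] with ω h1 h2
        refine lintegral_congr fun y => ?_
        have hk' := hpath k hk.le ω
        have := stepFun_eq p (t + k) (riskRatioPath p ξ t M ω) h1 (by rw [hk']; exact h2)
          (cumReturn S t k ω) y
        simp only [Function.comp, Φ, Y, modelState]
        rw [hk'] at this
        rw [← this]

lemma IsRiskNeutral.lintegral_modelState (hQ : IsRiskNeutral P Q 𝒢 S h φ ξ (t + M))
    (hHN : IsHestonNandi P 𝒢 p S h z)
    (hM : IsPricingKernel P 𝒢 p S h φ ξ) (hα : 0 < p.alpha)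
    (hβ : 0 ≤ p.beta) (hω : 0 ≤ p.omega)
    (hη : ∀ τ, t + 1 ≤ τ → τ ≤ t + M → Measurable[𝒢 t] (varianceRiskRatio p ξ τ))
    {α : Type*} [MeasurableSpace α]
    {X : Ω → α} (hX : Measurable[𝒢 t] X) {f : α × ChainState → ℝ≥0∞} (hf : Measurable f)
    (m : ℕ) : ∀ k, k + m = M →
    ∫⁻ ω, f (X ω, modelState p S h ξ t M M ω) ∂Q =
      ∫⁻ ω, ∫⁻ w, f (X ω, w) ∂(chain p m (t + k) (modelState p S h ξ t M k ω)) ∂Q := by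
  induction m with
  | zero =>
    intro k hk
    obtain rfl : k = M := by omega
    refine lintegral_congr fun ω => ?_
    rw [chain, Kernel.id_apply, lintegral_dirac' _ (by fun_prop)]
  | succ m ih =>
    intro k hk
    rw [ih (k + 1) (by omega)]
    let g : α × ChainState → ℝ≥0∞ := fun q => ∫⁻ w, f (q.1, w) ∂(chain p m (t + k + 1) q.2)
    have hg : Measurable g := by
      have : Measurable (Function.uncurry fun (q : α × ChainState) (w : ChainState) =>
          f (q.1, w)) := hf.comp ((measurable_fst.comp measurable_fst).prodMk measurable_snd)
      exact this.lintegral_kernel_prod_right (κ := (chain p m (t + k + 1)).comap Prod.snd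
        measurable_snd)
    refine (hQ.lintegral_modelState_succ hHN hM hα hβ hω hη (by omega) hX hg).trans ?_
    refine lintegral_congr fun ω => ?_
    exact (lintegral_chain_succ _ _ _ _ (hf.comp measurable_prodMk_left)).symm

/-- The conditional law of the final state is that of the chain; the spot price is carried along as
a conditioning variable, for the payoff. -/
lemma IsRiskNeutral.hasCondKernel (hQ : IsRiskNeutral P Q 𝒢 S h φ ξ (t + M))
    (hHN : IsHestonNandi P 𝒢 p S h z)
    (hM : IsPricingKernel P 𝒢 p S h φ ξ) (hα : 0 < p.alpha)
    (hβ : 0 ≤ p.beta) (hω : 0 ≤ p.omega)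
    (hη : ∀ τ, t + 1 ≤ τ → τ ≤ t + M → Measurable[𝒢 t] (varianceRiskRatio p ξ τ)) :
    HasCondKernel (𝒢 t) Q (fun ω => (S t ω, modelState p S h ξ t M 0 ω))
      (modelState p S h ξ t M M) ((chain p M t).comap Prod.snd measurable_snd) := by
  intro A hA f hf
  have hA' := 𝒢.le t A hA
  classical
  let X : Ω → (ℝ × ChainState) × Prop := fun ω => ((S t ω, modelState p S h ξ t M 0 ω), ω ∈ A)
  have hX : Measurable[𝒢 t] X :=
    ((hHN.price_adapted t).prodMk (measurable_modelState hHN hM hη 0)).prodMk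
      ((@measurable_mem Ω A (𝒢 t)).2 hA)
  let g : ((ℝ × ChainState) × Prop) × ChainState → ℝ≥0∞ :=
    fun q => if q.1.2 then f (q.1.1, q.2) else 0
  have hg : Measurable g :=
    Measurable.ite (measurableSet_setOfPred.2 (by fun_prop)) (by fun_prop) (by fun_prop)
  have := hQ.lintegral_modelState hHN hM hα hβ hω hη hX hg M 0 (by omega)
  rw [← lintegral_indicator hA', ← lintegral_indicator hA']
  refine Eq.trans (lintegral_congr fun ω => ?_) (this.trans (lintegral_congr fun ω => ?_))
  · by_cases h : ω ∈ A <;> simp [g, X, h]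
  · by_cases h : ω ∈ A <;> simp [g, X, h]

end CondLaw

/-! ### The coefficient recursion -/

section Coefficients

variable (p : Params) (η : ℕ → ℝ) (T : ℕ) (s : ℂ)

/-- The recursion also produces the initial values `A(s, 1)`, `B(s, 1)` out of `A(s, 0) = 0`,
`B(s, 0) = 0`, so that no special case is needed for one period. -/
lemma coefB_succ (m : ℕ) : coefB p η T s (m + 1) =
    s * ((gammaStar p η (T - m - 1) : ℂ) - 1 / 2)
      - 1 / 2 * (gammaStar p η (T - m - 1) : ℂ) ^ 2
      + (betaStar p η (T - m) : ℂ) * coefB p η T s m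
      + (s - (gammaStar p η (T - m - 1) : ℂ)) ^ 2
        / (2 * (1 - 2 * (alphaStar p η (T - m) : ℂ) * coefB p η T s m)) := by
  cases m with
  | zero => simp only [coefB]; ring
  | succ m => rw [coefB]

lemma coefA_succ (m : ℕ) : coefA p η T s (m + 1) =
    coefA p η T s m + s * p.r + coefB p η T s m * (omegaStar p η (T - m) : ℂ)
      - 1 / 2 * Complex.log (1 - 2 * (alphaStar p η (T - m) : ℂ) * coefB p η T s m) := by
  cases m with
  | zero => simp [coefA, coefB]
  | succ m => rw [coefA]

variable {p η T s}

lemma coefB_congr {η' : ℕ → ℝ} {m : ℕ} (hm : m ≤ T)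
    (h : ∀ τ, T - m ≤ τ → τ < T → η τ = η' τ) : coefB p η T s m = coefB p η' T s m := by
  induction m with
  | zero => rfl
  | succ m ih =>
    have h1 := ih (by omega) fun τ h1 h2 => h τ (by omega) h2
    rcases Nat.eq_zero_or_pos m with rfl | hm0
    · rfl
    have h2 := h (T - m) (by omega) (by omega)
    have h3 := h (T - m - 1) (by omega) (by omega)
    simp only [coefB_succ, h1, gammaStar, betaStar, alphaStar, h2, h3]

lemma coefA_congr {η' : ℕ → ℝ} {m : ℕ} (hm : m ≤ T)
    (h : ∀ τ, T - m ≤ τ → τ < T → η τ = η' τ) : coefA p η T s m = coefA p η' T s m := by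
  induction m with
  | zero => rfl
  | succ m ih =>
    have h1 := ih (by omega) fun τ h1 h2 => h τ (by omega) h2
    have h4 : coefB p η T s m = coefB p η' T s m :=
      coefB_congr (by omega) fun τ h1 h2 => h τ (by omega) h2
    rcases Nat.eq_zero_or_pos m with rfl | hm0
    · rfl
    have h2 := h (T - m) (by omega) (by omega)
    have h3 := h (T - m - 1) (by omega) (by omega)
    simp only [coefA_succ, h1, h4, omegaStar, alphaStar, h2, h3]

lemma coefB_ofReal (σ : ℝ) (m : ℕ) : coefB p η T (σ : ℂ) m = ((coefB p η T (σ : ℂ) m).re : ℂ) := by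
  suffices ∃ b : ℝ, coefB p η T (σ : ℂ) m = b by
    obtain ⟨b, hb⟩ := this
    rw [hb, Complex.ofReal_re]
  induction m with
  | zero => exact ⟨0, by simp [coefB]⟩
  | succ m ih =>
    obtain ⟨b, hb⟩ := ih
    rw [coefB_succ, hb]
    exact ⟨σ * (gammaStar p η (T - m - 1) - 1 / 2) - 1 / 2 * gammaStar p η (T - m - 1) ^ 2
      + betaStar p η (T - m) * b + (σ - gammaStar p η (T - m - 1)) ^ 2
        / (2 * (1 - 2 * alphaStar p η (T - m) * b)), by push_cast; ring⟩

variable (p η T) in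
/-- The condition on the real exponent `σ` under which the first `m` Gaussian integrals of the
backward recursion converge. -/
def GoodExponent (σ : ℝ) (m : ℕ) : Prop :=
  ∀ k < m, 2 * alphaStar p η (T - k) * (coefB p η T (σ : ℂ) k).re < 1

lemma re_sq_div_le {w q : ℂ} {c : ℝ} (hc : 0 < c) (hq : c ≤ q.re) :
    (w ^ 2 / (2 * q)).re ≤ w.re ^ 2 / (2 * c) := by
  have hqre : 0 < q.re := hc.trans_le hq
  have hn : 0 < q.re ^ 2 + q.im ^ 2 := by positivity
  have h1 : (w ^ 2 / (2 * q)).re = ((w.re ^ 2 - w.im ^ 2) * q.re + 2 * w.re * w.im * q.im) /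
      (2 * (q.re ^ 2 + q.im ^ 2)) := by
    rw [mul_comm (2 : ℂ) q, ← div_div, show (2 : ℂ) = ((2 : ℝ) : ℂ) by push_cast; rfl,
      Complex.div_ofReal_re, Complex.div_re, Complex.normSq_apply]
    simp only [pow_two, Complex.mul_re, Complex.mul_im]
    field_simp
    ring
  refine le_trans ?_ (div_le_div_of_nonneg_left (sq_nonneg _) (by positivity)
    (mul_le_mul_of_nonneg_left hq two_pos.le))
  rw [h1, div_le_div_iff₀ (by positivity) (by positivity)]
  nlinarith [sq_nonneg (w.re * q.im - w.im * q.re)]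

lemma alphaStar_pos (hα : 0 < p.alpha) (hη : ∀ τ, 0 < η τ) (τ : ℕ) : 0 < alphaStar p η τ :=
  mul_pos (mul_pos hα (hη _)) (hη _)

lemma betaStar_nonneg (hβ : 0 ≤ p.beta) (hη : ∀ τ, 0 < η τ) (τ : ℕ) : 0 ≤ betaStar p η τ :=
  mul_nonneg hβ (div_pos (hη _) (hη _)).le

lemma omegaStar_nonneg (hω : 0 ≤ p.omega) (hη : ∀ τ, 0 < η τ) (τ : ℕ) : 0 ≤ omegaStar p η τ :=
  mul_nonneg hω (hη _).le

/-- The real part of `B(s, m)` is largest on the real axis: in each step, `Re (w² / q)` is at most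
`(Re w)² / Re q` (`re_sq_div_le`). -/
lemma coefB_re_le (hα : 0 < p.alpha) (hβ : 0 ≤ p.beta) (hη : ∀ τ, 0 < η τ) {m : ℕ}
    (hg : GoodExponent p η T s.re m) :
    (coefB p η T s m).re ≤ (coefB p η T (s.re : ℂ) m).re := by
  induction m with
  | zero => simp [coefB]
  | succ m ih =>
    have ih := ih fun k hk => hg k (by omega)
    have hm := hg m (by omega)
    have ha := alphaStar_pos hα hη (T - m)
    have hb := betaStar_nonneg (p := p) hβ hη (T - m)
    rw [coefB_succ, coefB_succ, coefB_ofReal s.re m]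
    set B := coefB p η T s m
    set b := (coefB p η T (s.re : ℂ) m).re
    set g := gammaStar p η (T - m - 1)
    have hq : 1 - 2 * alphaStar p η (T - m) * b ≤
        (1 - 2 * (alphaStar p η (T - m) : ℂ) * B).re := by
      have : (1 - 2 * (alphaStar p η (T - m) : ℂ) * B).re =
          1 - 2 * alphaStar p η (T - m) * B.re := by
        simp
      rw [this]
      nlinarith
    have h1 := re_sq_div_le (w := s - g) (by linarith) hq
    have h2 : ((s.re : ℂ) * ((g : ℂ) - 1 / 2) - 1 / 2 * (g : ℂ) ^ 2 +
        (betaStar p η (T - m) : ℂ) * (b : ℂ) + ((s.re : ℂ) - g) ^ 2 /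
          (2 * (1 - 2 * (alphaStar p η (T - m) : ℂ) * (b : ℂ)))).re =
        s.re * (g - 1 / 2) - 1 / 2 * g ^ 2 + betaStar p η (T - m) * b + (s.re - g) ^ 2 /
          (2 * (1 - 2 * alphaStar p η (T - m) * b)) := by
      rw [← Complex.ofReal_re (s.re * (g - 1 / 2) - 1 / 2 * g ^ 2 + betaStar p η (T - m) * b +
        (s.re - g) ^ 2 / (2 * (1 - 2 * alphaStar p η (T - m) * b)))]
      push_cast; rfl
    have h3 : (s * ((g : ℂ) - 1 / 2) - 1 / 2 * (g : ℂ) ^ 2 + (betaStar p η (T - m) : ℂ) * B).re =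
        s.re * (g - 1 / 2) - 1 / 2 * g ^ 2 + betaStar p η (T - m) * B.re := by
      rw [show s * ((g : ℂ) - 1 / 2) - 1 / 2 * (g : ℂ) ^ 2 + (betaStar p η (T - m) : ℂ) * B =
        s * ((g - 1 / 2 : ℝ) : ℂ) - ((1 / 2 * g ^ 2 : ℝ) : ℂ) + (betaStar p η (T - m) : ℂ) * B by
          push_cast; ring]
      simp [-Complex.ofReal_sub, -Complex.ofReal_mul, -Complex.ofReal_pow]
    rw [h2, Complex.add_re, h3]
    have h4 : (s - (g : ℂ)).re = s.re - g := by simp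
    rw [h4] at h1
    have := mul_le_mul_of_nonneg_left ih hb
    linarith

lemma alphaStar_mul_coefB_re_lt (hα : 0 < p.alpha) (hβ : 0 ≤ p.beta) (hη : ∀ τ, 0 < η τ) {m : ℕ}
    (hg : GoodExponent p η T s.re (m + 1)) :
    alphaStar p η (T - m) * (coefB p η T s m).re < 1 / 2 := by
  have h1 := coefB_re_le hα hβ hη (m := m) fun k hk => hg k (by omega)
  have h2 := hg m (by omega)
  have := mul_le_mul_of_nonneg_left h1 (alphaStar_pos hα hη (T - m)).le
  linarith

/-- At `s = 0` this reflects total mass one, at `s = 1` the martingale property of the discounted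
price. -/
lemma coefB_eq_zero {σ : ℂ} (hσ : σ = 0 ∨ σ = 1) (m : ℕ) : coefB p η T σ m = 0 := by
  induction m with
  | zero => rfl
  | succ m ih => rw [coefB_succ, ih]; rcases hσ with rfl | rfl <;> ring

lemma goodExponent_of_eq {σ : ℝ} (hσ : σ = 0 ∨ σ = 1) (m : ℕ) : GoodExponent p η T σ m := by
  intro k _
  rw [coefB_eq_zero (by rcases hσ with rfl | rfl <;> simp)]
  simp

lemma continuousAt_coefB {σ : ℂ} (hσ : σ = 0 ∨ σ = 1) (m : ℕ) :
    ContinuousAt (fun s => coefB p η T s m) σ := by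
  induction m with
  | zero => exact continuousAt_const
  | succ m ih =>
    simp_rw [coefB_succ]
    have h0 : 2 * (1 - 2 * (alphaStar p η (T - m) : ℂ) * coefB p η T σ m) ≠ 0 := by
      rw [coefB_eq_zero hσ]; norm_num
    refine ContinuousAt.add (ContinuousAt.add (by fun_prop) (continuousAt_const.mul ih))
      (ContinuousAt.div (by fun_prop) ?_ h0)
    exact continuousAt_const.mul (continuousAt_const.sub (continuousAt_const.mul ih))

lemma eventually_goodExponent {σ : ℝ} (hσ : σ = 0 ∨ σ = 1) (m : ℕ) :
    ∀ᶠ σ' in nhds σ, GoodExponent p η T σ' m := by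
  have hσ' : (σ : ℂ) = 0 ∨ (σ : ℂ) = 1 := by rcases hσ with rfl | rfl <;> simp
  have : ∀ k ∈ Finset.range m, ∀ᶠ σ' : ℝ in nhds σ,
      2 * alphaStar p η (T - k) * (coefB p η T (σ' : ℂ) k).re < 1 := by
    intro k _
    have hc : ContinuousAt (fun σ' : ℝ => 2 * alphaStar p η (T - k) *
        (coefB p η T (σ' : ℂ) k).re) σ :=
      continuousAt_const.mul (Complex.continuous_re.continuousAt.comp
        (ContinuousAt.comp (f := fun x : ℝ => (x : ℂ)) (continuousAt_coefB hσ' k)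
          Complex.continuous_ofReal.continuousAt))
    refine hc.eventually (Iio_mem_nhds ?_)
    simp [coefB_eq_zero hσ']
  filter_upwards [(Filter.eventually_all_finset _).2 this] with σ' h k hk
  exact h k (Finset.mem_range.2 hk)

/-- Decay of the moment generating function along the lines `Re s = 0` and `Re s = 1`, in terms of
its exponent. For one period it comes from the Gaussian factor `exp (- (Im s)² h* / 2)`, for more
periods from the logarithm of `1 - 2 α* B(s, 1)`. -/
lemma exists_exponent_re_le (hα : 0 < p.alpha) (hβ : 0 ≤ p.beta) (hω : 0 ≤ p.omega)
    (hη : ∀ τ, 0 < η τ) {m : ℕ} (hm : 1 ≤ m) {v : ℝ} (hv : 0 < v) :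
    ∃ c : ℝ, 0 < c ∧ ∀ s : ℂ, s.re = 0 ∨ s.re = 1 →
      (coefA p η T s m + coefB p η T s m * (v : ℂ)).re ≤
        s.re * p.r * m - 1 / 2 * Real.log (1 + c * s.im ^ 2) := by
  have hB : ∀ s : ℂ, s.re = 0 ∨ s.re = 1 → ∀ k, (coefB p η T s k).re ≤ 0 := by
    intro s hs k
    have := coefB_re_le hα hβ hη (T := T) (s := s) (goodExponent_of_eq hs k)
    rwa [coefB_eq_zero (σ := (s.re : ℂ)) (by rcases hs with h | h <;> rw [h] <;> simp),
      Complex.zero_re] at this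
  have hB1 : ∀ s : ℂ, s.re = 0 ∨ s.re = 1 → (coefB p η T s 1).re = -(s.im ^ 2 / 2) := by
    intro s hs
    have : (coefB p η T s 1).re = 1 / 2 * (s.re ^ 2 - s.im ^ 2 - s.re) := by
      rw [coefB, show (1 / 2 : ℂ) = ((1 / 2 : ℝ) : ℂ) by push_cast; ring, Complex.re_ofReal_mul,
        Complex.sub_re, pow_two, Complex.mul_re]
      ring
    rw [this]
    rcases hs with h | h <;> rw [h] <;> ring
  rcases hm.eq_or_lt with rfl | hm2
  · refine ⟨v, hv, fun s hs => ?_⟩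
    have h1 : (coefA p η T s 1 + coefB p η T s 1 * (v : ℂ)).re =
        s.re * p.r + -(s.im ^ 2 / 2) * v := by
      rw [Complex.add_re, Complex.re_mul_ofReal, hB1 s hs, coefA, Complex.re_mul_ofReal]
    rw [h1]
    have : Real.log (1 + v * s.im ^ 2) ≤ v * s.im ^ 2 := by
      have := Real.log_le_sub_one_of_pos (x := 1 + v * s.im ^ 2) (by positivity)
      linarith
    push_cast
    linarith
  · have ha := alphaStar_pos hα hη (T - 1)
    refine ⟨alphaStar p η (T - 1), ha, fun s hs => ?_⟩
    have hlog : ∀ k, Real.log (1 + -(2 * alphaStar p η (T - k) * (coefB p η T s k).re)) ≤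
        (Complex.log (1 - 2 * (alphaStar p η (T - k) : ℂ) * coefB p η T s k)).re := by
      intro k
      have hak := alphaStar_pos hα hη (T - k)
      have := mul_nonpos_of_nonneg_of_nonpos hak.le (hB s hs k)
      rw [Complex.log_re]
      refine Real.log_le_log (by linarith) (le_trans (le_of_eq ?_) (Complex.re_le_norm _))
      simp [sub_eq_add_neg]
    have hA : ∀ k, (coefA p η T s (k + 1)).re ≤ (coefA p η T s k).re + s.re * p.r
        - 1 / 2 * Real.log (1 + -(2 * alphaStar p η (T - k) * (coefB p η T s k).re)) := by
      intro k
      have h1 := mul_nonpos_of_nonpos_of_nonneg (hB s hs k)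
        (omegaStar_nonneg hω hη (T - k))
      have h2 := hlog k
      rw [coefA_succ, Complex.sub_re, Complex.add_re, Complex.add_re, Complex.re_mul_ofReal,
        Complex.re_mul_ofReal, show (1 / 2 : ℂ) = ((1 / 2 : ℝ) : ℂ) by push_cast; ring,
        Complex.re_ofReal_mul]
      linarith
    have hA2 : ∀ k, (coefA p η T s (k + 2)).re ≤ s.re * p.r * (k + 2)
        - 1 / 2 * Real.log (1 + alphaStar p η (T - 1) * s.im ^ 2) := by
      intro k
      induction k with
      | zero =>
        have h1 := hA 1
        rw [hB1 s hs] at h1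
        have h2 : (coefA p η T s 1).re = s.re * p.r := by rw [coefA, Complex.re_mul_ofReal]
        have h3 : -(2 * alphaStar p η (T - 1) * -(s.im ^ 2 / 2)) =
          alphaStar p η (T - 1) * s.im ^ 2 := by ring
        rw [h2, h3] at h1
        push_cast
        linarith
      | succ k ih =>
        have h1 := hA (k + 2)
        have h2 : 0 ≤ Real.log (1 + -(2 * alphaStar p η (T - (k + 2)) *
            (coefB p η T s (k + 2)).re)) := by
          refine Real.log_nonneg ?_
          have := mul_nonpos_of_nonneg_of_nonpos (alphaStar_pos hα hη (T - (k + 2))).le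
            (hB s hs (k + 2))
          linarith
        push_cast
        linarith
    obtain ⟨k, rfl⟩ : ∃ k, m = k + 2 := ⟨m - 2, by omega⟩
    have h1 := mul_nonpos_of_nonpos_of_nonneg (hB s hs (k + 2)) hv.le
    have h2 := hA2 k
    rw [Complex.add_re, Complex.re_mul_ofReal]
    push_cast
    linarith

end Coefficients

/-! ### The moment generating function of the chain -/

section MGF

variable {p : Params} {η : ℕ → ℝ} {T : ℕ}

lemma integrable_chain_succ_iff {m u : ℕ} {a : ChainState} {f : ChainState → ℝ}
    (hf : Measurable f) :
    Integrable f (chain p (m + 1) u a) ↔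
      (∀ᵐ y ∂(gaussianReal 0 1), Integrable f (chain p m (u + 1) (stepFun p u (a, y)))) ∧
      Integrable (fun y => ∫ w, ‖f w‖ ∂(chain p m (u + 1) (stepFun p u (a, y))))
        (gaussianReal 0 1) := by
  have hm : Measurable fun y => stepFun p u (a, y) :=
    (measurable_stepFun p u).comp measurable_prodMk_left
  have hset : MeasurableSet {x | Integrable f (chain p m (u + 1) x)} := by
    exact measurableSet_kernel_integrable (f := fun _ => f)
      (hf.comp measurable_snd).stronglyMeasurable
  have hint : StronglyMeasurable fun x => ∫ w, ‖f w‖ ∂(chain p m (u + 1) x) :=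
    hf.norm.stronglyMeasurable.integral_kernel
  rw [chain, integrable_comp_iff hf.aestronglyMeasurable, stepKernel_apply,
    ae_map_iff hm.aemeasurable hset, integrable_map_measure hint.aestronglyMeasurable
      hm.aemeasurable]
  rfl

lemma integral_chain_succ {m u : ℕ} {a : ChainState} {f : ChainState → ℂ} (hf : Measurable f)
    (hi : Integrable f (chain p (m + 1) u a)) :
    ∫ w, f w ∂(chain p (m + 1) u a) =
      ∫ y, ∫ w, f w ∂(chain p m (u + 1) (stepFun p u (a, y))) ∂(gaussianReal 0 1) := by
  have hm : Measurable fun y => stepFun p u (a, y) :=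
    (measurable_stepFun p u).comp measurable_prodMk_left
  rw [chain] at hi ⊢
  rw [Kernel.integral_comp hi, stepKernel_apply, integral_map hm.aemeasurable]
  exact hf.stronglyMeasurable.integral_kernel.aestronglyMeasurable

/-- Exponent of the integrand of one backward step, as a quadratic polynomial in the shock. -/
lemma step_exponent (A B s : ℂ) (u : ℕ) {v : ℝ} (hv : 0 ≤ v) (x y : ℝ) :
    s * ((stepFun p u ((η, v, x), y)).2.2 : ℂ) + A + B * ((stepFun p u ((η, v, x), y)).2.1 : ℂ) =
      ((alphaStar p η (u + 1) : ℂ) * B) * (y : ℂ) ^ 2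
      + ((Real.sqrt v : ℂ) *
          (s - 2 * (alphaStar p η (u + 1) : ℂ) * B * (gammaStar p η u : ℂ))) * (y : ℂ)
      + (s * (x + p.r - v / 2) + A + B * (omegaStar p η (u + 1) + betaStar p η (u + 1) * v
          + alphaStar p η (u + 1) * (gammaStar p η u : ℂ) ^ 2 * v)) := by
  have hs : (Real.sqrt v : ℂ) ^ 2 = (v : ℂ) := by
    rw [← Complex.ofReal_pow, Real.sq_sqrt hv]
  simp only [stepFun]
  push_cast
  linear_combination (B * (alphaStar p η (u + 1) : ℂ) * (gammaStar p η u : ℂ) ^ 2) * hs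

lemma stepFun_variance_nonneg (hα : 0 < p.alpha) (hβ : 0 ≤ p.beta) (hω : 0 ≤ p.omega)
    (hη : ∀ τ, 0 < η τ) (u : ℕ) {v : ℝ} (hv : 0 ≤ v) (x y : ℝ) :
    0 ≤ (stepFun p u ((η, v, x), y)).2.1 := by
  have h1 := alphaStar_pos hα hη (u + 1)
  have h2 := betaStar_nonneg (p := p) hβ hη (u + 1)
  have h3 := omegaStar_nonneg (p := p) hω hη (u + 1)
  simp only [stepFun]
  positivity

lemma integral_norm_exp_eq {μ : Measure ChainState} {σ : ℝ} {E : ℂ}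
    (h : ∫ w : ChainState, Complex.exp ((σ : ℂ) * w.2.2) ∂μ = Complex.exp E) :
    ∫ w : ChainState, ‖Real.exp (σ * w.2.2)‖ ∂μ = Real.exp E.re := by
  have h2 : ∀ w : ChainState, Complex.exp ((σ : ℂ) * (w.2.2 : ℂ)) =
      ((‖Real.exp (σ * w.2.2)‖ : ℝ) : ℂ) := by
    intro w
    rw [Real.norm_of_nonneg (Real.exp_pos _).le]; push_cast; rfl
  simp_rw [h2, integral_complex_ofReal] at h
  rw [← Complex.norm_exp, ← h, Complex.norm_real, Real.norm_of_nonneg]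
  exact integral_nonneg fun w => norm_nonneg _

/-- The moment generating function of the chain is exponentially affine in the variance. -/
lemma integral_exp_chain (hα : 0 < p.alpha) (hβ : 0 ≤ p.beta) (hω : 0 ≤ p.omega)
    (hη : ∀ τ, 0 < η τ) {σ : ℝ} (m : ℕ) (hg : GoodExponent p η T σ m) :
    ∀ u, u + m = T → ∀ v x : ℝ, 0 ≤ v →
      Integrable (fun w : ChainState => Real.exp (σ * w.2.2)) (chain p m u (η, v, x)) ∧
      ∀ s : ℂ, s.re = σ → ∫ w : ChainState, Complex.exp (s * w.2.2) ∂(chain p m u (η, v, x)) =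
        Complex.exp (s * x + coefA p η T s m + coefB p η T s m * v) := by
  induction m with
  | zero =>
    intro u _ v x _
    simp only [chain, Kernel.id_apply]
    refine ⟨integrable_dirac (by simp), fun s _ => ?_⟩
    rw [integral_dirac]
    simp [coefA, coefB]
  | succ m ih =>
    intro u hu v x hv
    have ih := ih (fun k hk => hg k (by omega)) (u + 1) (by omega)
    have hTm : T - m = u + 1 := by omega
    have hstep := fun y => ih (stepFun p u ((η, v, x), y)).2.1 (stepFun p u ((η, v, x), y)).2.2
      (stepFun_variance_nonneg hα hβ hω hη u hv x y)
    have hlt : ∀ s : ℂ, s.re = σ →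
        ((alphaStar p η (u + 1) : ℂ) * coefB p η T s m).re < 1 / 2 := by
      rintro s rfl
      rw [Complex.re_ofReal_mul, ← hTm]
      exact alphaStar_mul_coefB_re_lt hα hβ hη hg
    have hnorm : ∀ y, ∫ w : ChainState, ‖Real.exp (σ * w.2.2)‖
        ∂(chain p m (u + 1) (stepFun p u ((η, v, x), y))) = _ :=
      fun y => integral_norm_exp_eq ((hstep y).2 σ (Complex.ofReal_re σ))
    have hi : Integrable (fun w : ChainState => Real.exp (σ * w.2.2))
        (chain p (m + 1) u (η, v, x)) := by
      rw [integrable_chain_succ_iff (by fun_prop)]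
      refine ⟨ae_of_all _ fun y => (hstep y).1, ?_⟩
      simp_rw [hnorm, ← Complex.norm_exp, step_exponent _ _ _ u hv]
      exact (integrable_cexp_quadratic_gaussian (hlt σ (Complex.ofReal_re σ)) _ _).norm
    refine ⟨hi, fun s hs => ?_⟩
    have hic : Integrable (fun w : ChainState => Complex.exp (s * w.2.2))
        (chain p (m + 1) u (η, v, x)) := by
      refine (integrable_norm_iff (by fun_prop)).1 (hi.congr (ae_of_all _ fun w => ?_))
      simp [Complex.norm_exp, hs]
    rw [integral_chain_succ (by fun_prop) hic]
    have h3 : ∀ y, ∫ w : ChainState, Complex.exp (s * w.2.2)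
        ∂(chain p m (u + 1) (stepFun p u ((η, v, x), y))) = _ := fun y => (hstep y).2 s hs
    simp_rw [h3, step_exponent _ _ _ u hv]
    rw [integral_cexp_quadratic_gaussian (hlt s hs), coefA_succ, coefB_succ, hTm,
      Nat.add_sub_cancel]
    congr 1
    have hq : (1 - 2 * (alphaStar p η (u + 1) : ℂ) * coefB p η T s m) ≠ 0 := by
      intro h0
      have h1 := hlt s hs
      have h2 : (alphaStar p η (u + 1) : ℂ) * coefB p η T s m = ((1 / 2 : ℝ) : ℂ) := by
        push_cast; linear_combination (-(1 / 2 : ℂ)) * h0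
      rw [h2, Complex.ofReal_re] at h1
      exact lt_irrefl _ h1
    have hsv : (Real.sqrt v : ℂ) ^ 2 = (v : ℂ) := by
      rw [← Complex.ofReal_pow, Real.sq_sqrt hv]
    rw [mul_pow, hsv, ← mul_assoc 2 (alphaStar p η (u + 1) : ℂ)]
    generalize hq' : (1 - 2 * (alphaStar p η (u + 1) : ℂ) * coefB p η T s m) = q at hq ⊢
    have hB : 2 * (alphaStar p η (u + 1) : ℂ) * coefB p η T s m = 1 - q := by rw [← hq']; ring
    have hB' : coefB p η T s m * ((alphaStar p η (u + 1) : ℂ) * (gammaStar p η u : ℂ) ^ 2 * v) =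
        (1 - q) / 2 * (gammaStar p η u : ℂ) ^ 2 * v := by
      rw [← hB]; ring
    rw [hB, mul_add (coefB p η T s m), hB']
    field_simp
    ring

/-- If the cumulative return has a finite exponential moment, every Gaussian integral of the
backward recursion converges. -/
lemma goodExponent_of_integrable (hα : 0 < p.alpha) (hβ : 0 ≤ p.beta) (hω : 0 ≤ p.omega)
    (hη : ∀ τ, 0 < η τ) {σ : ℝ} (m : ℕ) :
    ∀ u, u + m = T → ∀ v x : ℝ, 0 ≤ v →
      Integrable (fun w : ChainState => Real.exp (σ * w.2.2)) (chain p m u (η, v, x)) →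
      GoodExponent p η T σ m := by
  induction m with
  | zero => intro _ _ _ _ _ _ k hk; omega
  | succ m ih =>
    intro u hu v x hv hi
    have hTm : T - m = u + 1 := by omega
    rw [integrable_chain_succ_iff (by fun_prop)] at hi
    have hnn := stepFun_variance_nonneg hα hβ hω hη u hv x
    obtain ⟨y, hy⟩ := hi.1.exists
    have hg := ih (u + 1) (by omega) _ _ (hnn y) hy
    have hstep := fun y => integral_exp_chain hα hβ hω hη m hg (u + 1) (by omega)
      (stepFun p u ((η, v, x), y)).2.1 (stepFun p u ((η, v, x), y)).2.2 (hnn y)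
    have hnorm : ∀ y, ∫ w : ChainState, ‖Real.exp (σ * w.2.2)‖
        ∂(chain p m (u + 1) (stepFun p u ((η, v, x), y))) = _ :=
      fun y => integral_norm_exp_eq ((hstep y).2 σ (Complex.ofReal_re σ))
    have hi2 := hi.2
    simp_rw [hnorm, step_exponent _ _ _ u hv] at hi2
    set B := (coefB p η T (σ : ℂ) m).re with hB
    have hre : ∀ (c d : ℂ) (y : ℝ), ((alphaStar p η (u + 1) : ℂ) * coefB p η T (σ : ℂ) m *
        (y : ℂ) ^ 2 + c * (y : ℂ) + d).re =
        alphaStar p η (u + 1) * B * y ^ 2 + c.re * y + d.re := by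
      intro c d y
      rw [Complex.add_re, Complex.add_re, ← Complex.ofReal_pow, Complex.re_mul_ofReal,
        Complex.re_mul_ofReal, Complex.re_ofReal_mul]
    simp_rw [hre] at hi2
    have hlt := lt_half_of_integrable_exp_quadratic hi2
    intro k hk
    rcases Nat.lt_succ_iff_lt_or_eq.1 hk with hk | rfl
    · exact hg k hk
    · rw [hTm]; linarith

end MGF

/-! ### Fourier inversion of the sign function -/

lemma integrableOn_exp_neg_mul {ε : ℝ} (hε : 0 < ε) :
    Integrable (fun u : ℝ => Real.exp (-ε * u)) (volume.restrict (Set.Ioi 0)) :=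
  exp_neg_integrableOn_Ioi 0 hε

lemma abs_sin_mul_div_le (u a : ℝ) : |Real.sin (u * a) / u| ≤ |a| := by
  rcases eq_or_ne u 0 with rfl | hu
  · simp
  rw [abs_div, div_le_iff₀ (abs_pos.2 hu), mul_comm, ← abs_mul]
  exact Real.abs_sin_le_abs

lemma integral_exp_neg_mul_cos {ε : ℝ} (hε : 0 < ε) (a : ℝ) :
    ∫ u in Set.Ioi (0 : ℝ), Real.exp (-ε * u) * Real.cos (u * a) = ε / (ε ^ 2 + a ^ 2) := by
  have h0 : ((-ε : ℂ) + a * Complex.I).re < 0 := by simpa using hε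
  have h := integral_exp_mul_complex_Ioi h0 0
  have hi := integrableOn_exp_mul_complex_Ioi h0 0
  have hre : ∀ u : ℝ, (Complex.exp (((-ε : ℂ) + a * Complex.I) * u)).re =
      Real.exp (-ε * u) * Real.cos (u * a) := by
    intro u
    rw [Complex.exp_re]
    simp [mul_comm]
  have h2 := Complex.reCLM.integral_comp_comm hi
  simp only [Complex.reCLM_apply, hre] at h2
  rw [h2, h]
  have h3 : (-Complex.exp (((-ε : ℂ) + a * Complex.I) * ((0 : ℝ) : ℂ)) /
      ((-ε : ℂ) + a * Complex.I)) = -(((-ε : ℂ) + a * Complex.I))⁻¹ := by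
    simp [neg_div]
  rw [h3, Complex.neg_re, Complex.inv_re, Complex.normSq_apply]
  simp
  field_simp

/-- The damped Dirichlet integral. -/
lemma integral_exp_neg_mul_sin_div {ε : ℝ} (hε : 0 < ε) (a : ℝ) :
    ∫ u in Set.Ioi (0 : ℝ), Real.exp (-ε * u) * (Real.sin (u * a) / u) = Real.arctan (a / ε) := by
  have hd : ∀ a : ℝ, HasDerivAt
      (fun a => ∫ u in Set.Ioi (0 : ℝ), Real.exp (-ε * u) * (Real.sin (u * a) / u))
      (ε / (ε ^ 2 + a ^ 2)) a := by
    intro a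
    rw [← integral_exp_neg_mul_cos hε a]
    refine (hasDerivAt_integral_of_dominated_loc_of_deriv_le
      (μ := volume.restrict (Set.Ioi 0))
      (F := fun a u => Real.exp (-ε * u) * (Real.sin (u * a) / u))
      (F' := fun a u => Real.exp (-ε * u) * Real.cos (u * a))
      (bound := fun u => Real.exp (-ε * u)) (s := Set.univ) Filter.univ_mem ?_ ?_ ?_ ?_
      (integrableOn_exp_neg_mul hε) ?_).2
    · exact Filter.Eventually.of_forall fun a => by
        refine Measurable.aestronglyMeasurable ?_
        fun_prop
    · refine ((integrableOn_exp_neg_mul hε).mul_const |a|).mono'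
        (Measurable.aestronglyMeasurable (by fun_prop)) (ae_of_all _ fun u => ?_)
      rw [norm_mul, Real.norm_of_nonneg (Real.exp_pos _).le]
      exact mul_le_mul_of_nonneg_left (abs_sin_mul_div_le u a) (Real.exp_pos _).le
    · exact Measurable.aestronglyMeasurable (by fun_prop)
    · refine ae_of_all _ fun u x _ => ?_
      rw [norm_mul, Real.norm_of_nonneg (Real.exp_pos _).le]
      exact mul_le_of_le_one_right (Real.exp_pos _).le (Real.abs_cos_le_one _)
    · refine (ae_restrict_iff' measurableSet_Ioi).2 (ae_of_all _ fun u hu x _ => ?_)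
      have hu' : u ≠ 0 := (Set.mem_Ioi.1 hu).ne'
      have := (((hasDerivAt_id x).const_mul u).sin.div_const u).const_mul (Real.exp (-ε * u))
      convert! this using 1
      simp only [id]
      field_simp
  have hd2 : ∀ a : ℝ, HasDerivAt (fun a => Real.arctan (a / ε)) (ε / (ε ^ 2 + a ^ 2)) a := by
    intro a
    convert! ((hasDerivAt_id a).div_const ε).arctan using 1
    simp only [id]
    have : ε ^ 2 + a ^ 2 ≠ 0 := by positivity
    field_simp
  have hconst := is_const_of_deriv_eq_zero
    (f := fun a => (∫ u in Set.Ioi (0 : ℝ), Real.exp (-ε * u) * (Real.sin (u * a) / u)) -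
      Real.arctan (a / ε))
    (fun a => ((hd a).sub (hd2 a)).differentiableAt)
    (fun a => ((hd a).sub (hd2 a)).deriv.trans (sub_self _)) a 0
  simpa [sub_eq_zero] using hconst

/-- Fourier inversion for the sign function (Gil-Pelaez), with a weight: the damped identity is a
Fubini computation, and the damping is removed by dominated convergence on both sides. -/
lemma integral_sin_div_eq_sign {α : Type*} [MeasurableSpace α] {ν : Measure α} [SFinite ν]
    {Y w : α → ℝ} (hY : Measurable Y) (hw : Measurable w) (hwi : Integrable w ν)
    (hYw : Integrable (fun x => |Y x| * w x) ν)
    (hI : IntegrableOn (fun u : ℝ => (∫ x, w x * Real.sin (u * Y x) ∂ν) / u) (Set.Ioi 0)) :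
    ∫ u in Set.Ioi (0 : ℝ), (∫ x, w x * Real.sin (u * Y x) ∂ν) / u =
      Real.pi / 2 * ∫ x, w x * Real.sign (Y x) ∂ν := by
  have fubini : ∀ ε : ℝ, 0 < ε →
      ∫ u in Set.Ioi (0 : ℝ), Real.exp (-ε * u) * ((∫ x, w x * Real.sin (u * Y x) ∂ν) / u) =
        ∫ x, w x * Real.arctan (Y x / ε) ∂ν := by
    intro ε hε
    have hint : Integrable (Function.uncurry fun (u : ℝ) (x : α) =>
        w x * (Real.exp (-ε * u) * (Real.sin (u * Y x) / u)))
        ((volume.restrict (Set.Ioi 0)).prod ν) := by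
      refine ((integrableOn_exp_neg_mul hε).mul_prod hYw).mono
        (Measurable.aestronglyMeasurable (by fun_prop)) (ae_of_all _ fun q => ?_)
      simp only [Function.uncurry, norm_mul, Real.norm_eq_abs, abs_abs]
      have := abs_sin_mul_div_le q.1 (Y q.2)
      calc |w q.2| * (|Real.exp (-ε * q.1)| * |Real.sin (q.1 * Y q.2) / q.1|)
          ≤ |w q.2| * (|Real.exp (-ε * q.1)| * |Y q.2|) := by gcongr
        _ = _ := by ring
    calc _ = ∫ u in Set.Ioi (0 : ℝ),
            ∫ x, w x * (Real.exp (-ε * u) * (Real.sin (u * Y x) / u)) ∂ν := by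
          refine integral_congr_ae (ae_of_all _ fun u => ?_)
          simp only
          rw [← integral_div, ← integral_const_mul]
          refine integral_congr_ae (ae_of_all _ fun x => ?_)
          simp only; ring
      _ = ∫ x, (∫ u in Set.Ioi (0 : ℝ),
            w x * (Real.exp (-ε * u) * (Real.sin (u * Y x) / u))) ∂ν :=
          integral_integral_swap hint
      _ = _ := by
          simp_rw [integral_const_mul, integral_exp_neg_mul_sin_div hε]
  have lim1 : Filter.Tendsto (fun ε : ℝ => ∫ u in Set.Ioi (0 : ℝ),
      Real.exp (-ε * u) * ((∫ x, w x * Real.sin (u * Y x) ∂ν) / u)) (nhdsWithin 0 (Set.Ioi 0))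
      (nhds (∫ u in Set.Ioi (0 : ℝ), (∫ x, w x * Real.sin (u * Y x) ∂ν) / u)) := by
    refine tendsto_integral_filter_of_dominated_convergence
      (fun u => |(∫ x, w x * Real.sin (u * Y x) ∂ν) / u|) ?_ ?_ hI.abs ?_
    · refine Filter.Eventually.of_forall fun ε => ?_
      exact (Measurable.aestronglyMeasurable (by fun_prop)).mul hI.aestronglyMeasurable
    · refine eventually_nhdsWithin_of_forall fun ε hε => ?_
      refine (ae_restrict_iff' measurableSet_Ioi).2 (ae_of_all _ fun u hu => ?_)
      rw [norm_mul, Real.norm_of_nonneg (Real.exp_pos _).le]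
      refine mul_le_of_le_one_left (abs_nonneg _) (Real.exp_le_one_iff.2 ?_)
      have := mul_pos (Set.mem_Ioi.1 hε) (Set.mem_Ioi.1 hu)
      linarith
    · refine ae_of_all _ fun u => ?_
      have : Filter.Tendsto (fun ε : ℝ => Real.exp (-ε * u) *
          ((∫ x, w x * Real.sin (u * Y x) ∂ν) / u)) (nhds 0)
          (nhds (Real.exp (-0 * u) * ((∫ x, w x * Real.sin (u * Y x) ∂ν) / u))) :=
        Continuous.tendsto (by fun_prop) 0
      simp only [neg_zero, zero_mul, Real.exp_zero, one_mul] at this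
      exact this.mono_left nhdsWithin_le_nhds
  have lim2 : Filter.Tendsto (fun ε : ℝ => ∫ x, w x * Real.arctan (Y x / ε) ∂ν)
      (nhdsWithin 0 (Set.Ioi 0)) (nhds (∫ x, w x * (Real.pi / 2 * Real.sign (Y x)) ∂ν)) := by
    refine tendsto_integral_filter_of_dominated_convergence
      (fun x => |w x| * (Real.pi / 2)) ?_ ?_ (hwi.abs.mul_const _) ?_
    · exact Filter.Eventually.of_forall fun ε =>
        (hw.mul (Real.measurable_arctan.comp (hY.div_const ε))).aestronglyMeasurable
    · refine Filter.Eventually.of_forall fun ε => ae_of_all _ fun x => ?_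
      rw [norm_mul, Real.norm_eq_abs, Real.norm_eq_abs]
      exact mul_le_mul_of_nonneg_left
        (abs_lt.2 ⟨Real.neg_pi_div_two_lt_arctan _, Real.arctan_lt_pi_div_two _⟩).le (abs_nonneg _)
    · refine ae_of_all _ fun x => Filter.Tendsto.const_mul _ ?_
      have hinv := tendsto_inv_nhdsGT_zero (𝕜 := ℝ)
      rcases lt_trichotomy (Y x) 0 with h | h | h
      · rw [Real.sign_of_neg h]
        have : Filter.Tendsto (fun ε : ℝ => Y x / ε) (nhdsWithin 0 (Set.Ioi 0)) Filter.atBot := by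
          simp_rw [div_eq_mul_inv]
          exact hinv.const_mul_atTop_of_neg h
        have h2 := (Real.tendsto_arctan_atBot.mono_right nhdsWithin_le_nhds).comp this
        simpa using! h2
      · simp [h]
      · rw [Real.sign_of_pos h]
        have : Filter.Tendsto (fun ε : ℝ => Y x / ε) (nhdsWithin 0 (Set.Ioi 0)) Filter.atTop := by
          simp_rw [div_eq_mul_inv]
          exact hinv.const_mul_atTop h
        have h2 := (Real.tendsto_arctan_atTop.mono_right nhdsWithin_le_nhds).comp this
        simpa using! h2
  have hev : ∀ᶠ ε in nhdsWithin (0 : ℝ) (Set.Ioi 0), ∫ u in Set.Ioi (0 : ℝ),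
      Real.exp (-ε * u) * ((∫ x, w x * Real.sin (u * Y x) ∂ν) / u) =
        ∫ x, w x * Real.arctan (Y x / ε) ∂ν :=
    eventually_nhdsWithin_of_forall fun ε hε => fubini ε hε
  have lim1' := lim1.congr' hev
  rw [tendsto_nhds_unique lim1' lim2, ← integral_const_mul]
  refine integral_congr_ae (ae_of_all _ fun x => ?_)
  simp only; ring

/-! ### The call price as a Fourier integral -/

section CallPrice

variable {μ : Measure ℝ}

lemma re_div_I_mul (c : ℂ) (u : ℝ) : (c / (Complex.I * u)).re = c.im / u := by
  rw [← div_div, Complex.div_ofReal_re, Complex.div_I]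
  simp

/-- `σ = 0` gives the integrand of `P₂` and `σ = 1` that of `P₁`. -/
lemma im_cexp_mul_complexMGF {σ : ℝ} (hσ : Integrable (fun y : ℝ => Real.exp (σ * y)) μ) (θ u : ℝ) :
    (Complex.exp (Complex.I * u * θ) * complexMGF id μ (Complex.I * u + σ)).im =
      ∫ y, Real.exp (σ * y) * Real.sin (u * (y + θ)) ∂μ := by
  have hi : Integrable (fun y : ℝ => Complex.exp (Complex.I * u * θ) *
      Complex.exp ((Complex.I * u + σ) * (id y : ℝ))) μ := by
    refine Integrable.const_mul ((integrable_norm_iff ?_).1 (hσ.congr (ae_of_all _ fun y => ?_))) _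
    · exact Measurable.aestronglyMeasurable (by fun_prop)
    · simp [Complex.norm_exp]
  rw [complexMGF, ← integral_const_mul]
  refine (Complex.imCLM.integral_comp_comm hi).symm.trans ?_
  refine integral_congr_ae (ae_of_all _ fun y => ?_)
  have : Complex.exp (Complex.I * u * θ) * Complex.exp ((Complex.I * u + σ) * (id y : ℝ)) =
      Complex.exp ((σ * y : ℝ) + (u * (y + θ) : ℝ) * Complex.I) := by
    rw [← Complex.exp_add]; congr 1; simp only [id]; push_cast; ring
  simp only [Complex.imCLM_apply]
  rw [this, Complex.exp_im]
  simp

lemma integrandP2_eq [IsFiniteMeasure μ] {K x : ℝ} (hK : 0 < K) (hx : 0 < x) (u : ℝ) :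
    integrandP2 K x (complexMGF id μ) u =
      (∫ y, Real.exp (0 * y) * Real.sin (u * (y + (Real.log x - Real.log K))) ∂μ) / u := by
  have hK' : (K : ℂ) ≠ 0 := by exact_mod_cast hK.ne'
  have hx' : (x : ℂ) ≠ 0 := by exact_mod_cast hx.ne'
  rw [← im_cexp_mul_complexMGF (by simp), ← re_div_I_mul, integrandP2]
  rw [Complex.cpow_def_of_ne_zero hK', Complex.cpow_def_of_ne_zero hx', ← mul_assoc,
    ← Complex.exp_add, ← Complex.ofReal_log hK.le, ← Complex.ofReal_log hx.le]
  congr 3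
  · congr 1; push_cast; ring
  · simp

lemma integrandP1_eq {K x : ℝ} (hK : 0 < K) (hx : 0 < x)
    (h1 : Integrable (fun y : ℝ => Real.exp (1 * y)) μ) (u : ℝ) :
    integrandP1 K x (complexMGF id μ) u =
      (∫ y, Real.exp (1 * y) * Real.sin (u * (y + (Real.log x - Real.log K))) ∂μ) / u := by
  have hK' : (K : ℂ) ≠ 0 := by exact_mod_cast hK.ne'
  have hx' : (x : ℂ) ≠ 0 := by exact_mod_cast hx.ne'
  rw [← im_cexp_mul_complexMGF h1, ← re_div_I_mul, integrandP1]
  have e : (K : ℂ) ^ (-(Complex.I * u)) * ((x : ℂ) ^ (Complex.I * u + 1) *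
      complexMGF id μ (Complex.I * u + 1)) / (Complex.I * u * x) =
      (K : ℂ) ^ (-(Complex.I * u)) * (x : ℂ) ^ (Complex.I * u) *
        complexMGF id μ (Complex.I * u + 1) / (Complex.I * u) := by
    rw [Complex.cpow_add _ _ hx', Complex.cpow_one]
    field_simp
  rw [e, Complex.cpow_def_of_ne_zero hK', Complex.cpow_def_of_ne_zero hx',
    ← Complex.exp_add, ← Complex.ofReal_log hK.le, ← Complex.ofReal_log hx.le]
  congr 3
  · congr 1; push_cast; ring

lemma measurable_integral_exp_mul_sin [SFinite μ] (σ θ : ℝ) :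
    Measurable fun u : ℝ => ∫ y, Real.exp (σ * y) * Real.sin (u * (y + θ)) ∂μ :=
  (StronglyMeasurable.integral_prod_right
    (f := fun (u y : ℝ) => Real.exp (σ * y) * Real.sin (u * (y + θ)))
    (Measurable.stronglyMeasurable (by fun_prop))).measurable

/-- Near `0` the integrand is bounded by a first moment, at infinity by the decay of the moment
generating function. -/
lemma integrableOn_integral_exp_mul_sin_div [SFinite μ] {σ C θ : ℝ}
    (hσ : Integrable (fun y : ℝ => Real.exp (σ * y)) μ)
    (hm : Integrable (fun y : ℝ => |y + θ| * Real.exp (σ * y)) μ)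
    (hC : ∀ u : ℝ, 0 < u → ‖complexMGF id μ (Complex.I * u + σ)‖ ≤ C / u) :
    IntegrableOn (fun u : ℝ => (∫ y, Real.exp (σ * y) * Real.sin (u * (y + θ)) ∂μ) / u)
      (Set.Ioi 0) := by
  set D := ∫ y, |y + θ| * Real.exp (σ * y) ∂μ with hD
  refine Integrable.mono' ((integrable_inv_one_add_sq.const_mul (D + C)).integrableOn)
    ((measurable_integral_exp_mul_sin σ θ).div measurable_id).aestronglyMeasurable ?_
  refine (ae_restrict_iff' measurableSet_Ioi).2 (ae_of_all _ fun u hu => ?_)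
  have hu : 0 < u := hu
  set J := ∫ y, Real.exp (σ * y) * Real.sin (u * (y + θ)) ∂μ with hJ
  have b1 : |J| ≤ D * u := by
    rw [hJ, hD, ← integral_mul_const, ← Real.norm_eq_abs]
    refine norm_integral_le_of_norm_le (hm.mul_const u) (ae_of_all _ fun y => ?_)
    rw [norm_mul, Real.norm_of_nonneg (Real.exp_pos _).le, Real.norm_eq_abs]
    have h1 : |Real.sin (u * (y + θ))| ≤ |y + θ| * u := by
      refine Real.abs_sin_le_abs.trans (le_of_eq ?_)
      rw [abs_mul, abs_of_pos hu, mul_comm]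
    calc Real.exp (σ * y) * |Real.sin (u * (y + θ))| ≤ Real.exp (σ * y) * (|y + θ| * u) := by
          gcongr
      _ = _ := by ring
  have b2 : |J| ≤ C / u := by
    rw [hJ, ← im_cexp_mul_complexMGF hσ]
    refine (Complex.abs_im_le_norm _).trans ?_
    rw [norm_mul, Complex.norm_exp]
    have : (Complex.I * u * θ).re = 0 := by simp
    rw [this, Real.exp_zero, one_mul]
    exact hC u hu
  rw [le_div_iff₀ hu] at b2
  rw [Real.norm_eq_abs, abs_div, abs_of_pos hu, div_le_iff₀ hu, mul_assoc, ← div_eq_inv_mul,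
    mul_div_assoc', le_div_iff₀ (by positivity)]
  nlinarith [mul_le_mul_of_nonneg_right b2 hu.le]

/-- The call payoff in terms of the sign of the log-moneyness, for a log-return `y`. -/
lemma max_eq_sign {K x : ℝ} (hK : 0 < K) (hx : 0 < x) (y : ℝ) :
    max (x * Real.exp y - K) 0 =
      x / 2 * Real.exp y - K / 2 + (x / 2 * (Real.exp (1 * y) *
        Real.sign (y + (Real.log x - Real.log K)))
        - K / 2 * (Real.exp (0 * y) * Real.sign (y + (Real.log x - Real.log K)))) := by
  have e1 : Real.exp (y + Real.log x) = x * Real.exp y := by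
    rw [Real.exp_add, Real.exp_log hx, mul_comm]
  have e2 : Real.exp (Real.log K) = K := Real.exp_log hK
  rw [zero_mul, one_mul, Real.exp_zero, one_mul]
  rcases lt_trichotomy (y + (Real.log x - Real.log K)) 0 with h | h | h
  · have h1 := Real.exp_lt_exp.2 (show y + Real.log x < Real.log K by linarith)
    rw [e1, e2] at h1
    rw [Real.sign_of_neg h, max_eq_right (by linarith)]; ring
  · have h1 := congrArg Real.exp (show y + Real.log x = Real.log K by linarith)
    rw [e1, e2] at h1
    rw [h, Real.sign_zero, max_eq_right (by linarith)]; linarith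
  · have h1 := Real.exp_lt_exp.2 (show Real.log K < y + Real.log x by linarith)
    rw [e1, e2] at h1
    rw [Real.sign_of_pos h, max_eq_left (by linarith)]; ring

lemma measurable_sign : Measurable Real.sign := by
  unfold Real.sign
  exact Measurable.ite measurableSet_Iio measurable_const
    (Measurable.ite measurableSet_Ioi measurable_const measurable_const)

lemma integrable_abs_add_mul_exp {σ : ℝ} (hσ : σ ∈ interior (integrableExpSet id μ)) (θ : ℝ) :
    Integrable (fun y : ℝ => |y + θ| * Real.exp (σ * y)) μ := by
  have h1 := integrable_pow_abs_mul_exp_of_mem_interior_integrableExpSet hσ 1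
  have h0 : Integrable (fun y : ℝ => Real.exp (σ * y)) μ :=
    (interior_subset hσ : σ ∈ integrableExpSet id μ)
  simp only [id, pow_one] at h1
  refine (h1.add (h0.const_mul |θ|)).mono' (Measurable.aestronglyMeasurable (by fun_prop))
    (ae_of_all _ fun y => ?_)
  rw [norm_mul, Real.norm_of_nonneg (Real.exp_pos _).le, Real.norm_of_nonneg (abs_nonneg _)]
  simp only [Pi.add_apply]
  rw [← add_mul]
  exact mul_le_mul_of_nonneg_right (abs_add_le _ _) (Real.exp_pos _).le

/-- The call price for a log-return of law `μ`: the payoff is a combination of the sign of the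
log-moneyness with weights `1` and `exp y`, and Fourier inversion applies to each. Since the payoff
vanishes at the strike, atoms of `μ` do no harm. -/
lemma call_price_formula [IsProbabilityMeasure μ] {K x r C : ℝ} {M : ℕ} (hK : 0 < K) (hx : 0 < x)
    (h0 : (0 : ℝ) ∈ interior (integrableExpSet id μ))
    (h1 : (1 : ℝ) ∈ interior (integrableExpSet id μ))
    (hr : ∫ y, Real.exp y ∂μ = Real.exp (r * M))
    (hC : ∀ σ : ℝ, σ = 0 ∨ σ = 1 → ∀ u : ℝ, 0 < u →
      ‖complexMGF id μ (Complex.I * u + σ)‖ ≤ C / u) :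
    Integrable (fun y : ℝ => max (x * Real.exp y - K) 0) μ ∧
    IntegrableOn (integrandP1 K x (complexMGF id μ)) (Set.Ioi 0) ∧
    IntegrableOn (integrandP2 K x (complexMGF id μ)) (Set.Ioi 0) ∧
    Real.exp (-r * M) * ∫ y, max (x * Real.exp y - K) 0 ∂μ =
      x * probP1 r M K x (complexMGF id μ)
        - K * Real.exp (-r * M) * probP2 K x (complexMGF id μ) := by
  set θ := Real.log x - Real.log K with hθ
  have hi : ∀ σ : ℝ, σ = 0 ∨ σ = 1 → Integrable (fun y : ℝ => Real.exp (σ * y)) μ := by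
    rintro σ (rfl | rfl)
    exacts [(interior_subset h0 : 0 ∈ integrableExpSet id μ),
      (interior_subset h1 : 1 ∈ integrableExpSet id μ)]
  have hm : ∀ σ : ℝ, σ = 0 ∨ σ = 1 →
      Integrable (fun y : ℝ => |y + θ| * Real.exp (σ * y)) μ := by
    rintro σ (rfl | rfl)
    exacts [integrable_abs_add_mul_exp h0 θ, integrable_abs_add_mul_exp h1 θ]
  have hI := fun σ (hσ : σ = 0 ∨ σ = 1) =>
    integrableOn_integral_exp_mul_sin_div (hi σ hσ) (hm σ hσ) (hC σ hσ)
  have hF := fun σ (hσ : σ = 0 ∨ σ = 1) =>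
    integral_sin_div_eq_sign (ν := μ) (Y := fun y => y + θ) (w := fun y => Real.exp (σ * y))
      (by fun_prop) (by fun_prop) (hi σ hσ) (hm σ hσ) (hI σ hσ)
  have hS : ∀ σ : ℝ, σ = 0 ∨ σ = 1 →
      Integrable (fun y : ℝ => Real.exp (σ * y) * Real.sign (y + θ)) μ := by
    intro σ hσ
    refine (hi σ hσ).mono (Measurable.aestronglyMeasurable
      (Measurable.mul (by fun_prop) (measurable_sign.comp (by fun_prop)))) (ae_of_all _ fun y => ?_)
    rw [norm_mul]
    refine mul_le_of_le_one_right (norm_nonneg _) ?_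
    rcases Real.sign_apply_eq (y + θ) with h | h | h <;> simp [h]
  have e1 : integrandP1 K x (complexMGF id μ) = _ :=
    funext fun u => integrandP1_eq hK hx (hi 1 (Or.inr rfl)) u
  have e2 : integrandP2 K x (complexMGF id μ) = _ := funext fun u => integrandP2_eq hK hx u
  have hexp : Integrable (fun y : ℝ => Real.exp y) μ := by
    simpa using hi 1 (Or.inr rfl)
  have hlin : Integrable (fun y : ℝ => x / 2 * Real.exp y - K / 2) μ :=
    (hexp.const_mul _).sub (integrable_const _)
  have hsg : Integrable (fun y : ℝ => x / 2 * (Real.exp (1 * y) * Real.sign (y + θ))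
        - K / 2 * (Real.exp (0 * y) * Real.sign (y + θ))) μ :=
    ((hS 1 (Or.inr rfl)).const_mul _).sub ((hS 0 (Or.inl rfl)).const_mul _)
  refine ⟨?_, ?_, ?_, ?_⟩
  · simp_rw [max_eq_sign hK hx]
    exact hlin.add hsg
  · rw [e1]; exact hI 1 (Or.inr rfl)
  · rw [e2]; exact hI 0 (Or.inl rfl)
  · simp_rw [max_eq_sign hK hx]
    rw [integral_add hlin hsg, integral_sub (hexp.const_mul _) (integrable_const _),
      integral_sub ((hS 1 (Or.inr rfl)).const_mul _) ((hS 0 (Or.inl rfl)).const_mul _),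
      integral_const_mul, integral_const_mul, integral_const_mul, hr, integral_const,
      probP1, probP2, e1, e2, hF 1 (Or.inr rfl), hF 0 (Or.inl rfl)]
    have hpi := Real.pi_ne_zero
    have hee : Real.exp (-r * M) * Real.exp (r * M) = 1 := by
      rw [← Real.exp_add]; simp
    rw [neg_mul] at hee ⊢
    simp only [probReal_univ, one_smul]
    field_simp
    linear_combination x * hee

end CallPrice

/-! ### The law of the cumulative return -/

section ReturnLaw

/-- The law of the return over `m` periods from time `u`, when the variance risk ratio follows the
path `η` and the risk-neutral variance of the first return is `v`. -/
noncomputable def returnLaw (p : Params) (m u : ℕ) (η : ℕ → ℝ) (v : ℝ) : Measure ℝ :=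
  (chain p m u (η, v, 0)).map fun w => w.2.2

instance (p : Params) (m u : ℕ) (η : ℕ → ℝ) (v : ℝ) : IsProbabilityMeasure (returnLaw p m u η v) :=
  Measure.isProbabilityMeasure_map (by fun_prop)

variable {p : Params} {η : ℕ → ℝ} {m u : ℕ} {v : ℝ}

lemma integrable_exp_returnLaw_iff (hα : 0 < p.alpha) (hβ : 0 ≤ p.beta) (hω : 0 ≤ p.omega)
    (hη : ∀ τ, 0 < η τ) (hv : 0 ≤ v) {σ : ℝ} :
    Integrable (fun y => Real.exp (σ * y)) (returnLaw p m u η v) ↔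
      GoodExponent p η (u + m) σ m := by
  rw [returnLaw, integrable_map_measure (Measurable.aestronglyMeasurable (by fun_prop))
    (by fun_prop)]
  exact ⟨goodExponent_of_integrable hα hβ hω hη m u rfl v 0 hv,
    fun hg => (integral_exp_chain hα hβ hω hη m hg u rfl v 0 hv).1⟩

lemma complexMGF_returnLaw (hα : 0 < p.alpha) (hβ : 0 ≤ p.beta) (hω : 0 ≤ p.omega)
    (hη : ∀ τ, 0 < η τ) (hv : 0 ≤ v) {s : ℂ}
    (hs : Integrable (fun y => Real.exp (s.re * y)) (returnLaw p m u η v)) :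
    complexMGF id (returnLaw p m u η v) s =
      Complex.exp (coefA p η (u + m) s m + coefB p η (u + m) s m * v) := by
  have hg := (integrable_exp_returnLaw_iff hα hβ hω hη hv).1 hs
  have := (integral_exp_chain hα hβ hω hη m hg u rfl v 0 hv).2 s rfl
  rw [complexMGF, returnLaw, integral_map (by fun_prop)
    (Measurable.aestronglyMeasurable (by fun_prop))]
  simpa using this

lemma mem_interior_integrableExpSet_returnLaw (hα : 0 < p.alpha) (hβ : 0 ≤ p.beta)
    (hω : 0 ≤ p.omega) (hη : ∀ τ, 0 < η τ) (hv : 0 ≤ v) {σ : ℝ} (hσ : σ = 0 ∨ σ = 1) :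
    σ ∈ interior (integrableExpSet id (returnLaw p m u η v)) := by
  rw [mem_interior_iff_mem_nhds]
  filter_upwards [eventually_goodExponent (p := p) (η := η) (T := u + m) hσ m] with σ' h
  exact (integrable_exp_returnLaw_iff hα hβ hω hη hv).2 h

lemma coefA_one (T : ℕ) (m : ℕ) : coefA p η T 1 m = (p.r * m : ℝ) := by
  induction m with
  | zero => simp [coefA]
  | succ m ih =>
    rw [coefA_succ, ih, coefB_eq_zero (Or.inr rfl)]
    simp; ring

/-- The discounted price is a martingale under the risk-neutral measure. -/
lemma integral_exp_returnLaw (hα : 0 < p.alpha) (hβ : 0 ≤ p.beta)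
    (hω : 0 ≤ p.omega) (hη : ∀ τ, 0 < η τ) (hv : 0 ≤ v) :
    ∫ y, Real.exp y ∂(returnLaw p m u η v) = Real.exp (p.r * m) := by
  have h1 : Integrable (fun y => Real.exp ((1 : ℂ).re * y)) (returnLaw p m u η v) :=
    (integrable_exp_returnLaw_iff hα hβ hω hη hv).2 (goodExponent_of_eq (Or.inr rfl) m)
  have h2 := complexMGF_returnLaw hα hβ hω hη hv h1
  rw [coefA_one, coefB_eq_zero (Or.inr rfl), zero_mul, add_zero, complexMGF] at h2
  have h3 : ∀ y : ℝ, Complex.exp (1 * (id y : ℝ)) = (Real.exp y : ℂ) := by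
    intro y; simp
  simp_rw [h3, integral_complex_ofReal, ← Complex.ofReal_exp] at h2
  exact_mod_cast h2

lemma exists_norm_complexMGF_returnLaw_le (hα : 0 < p.alpha) (hβ : 0 ≤ p.beta)
    (hω : 0 ≤ p.omega) (hη : ∀ τ, 0 < η τ) (hv : 0 < v) (hm : 1 ≤ m) :
    ∃ C : ℝ, ∀ σ : ℝ, σ = 0 ∨ σ = 1 → ∀ x : ℝ, 0 < x →
      ‖complexMGF id (returnLaw p m u η v) (Complex.I * x + σ)‖ ≤ C / x := by
  obtain ⟨c, hc, hle⟩ := exists_exponent_re_le (T := u + m) hα hβ hω hη hm hv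
  refine ⟨Real.exp (|p.r| * m) / Real.sqrt c, fun σ hσ x hx => ?_⟩
  have hre : (Complex.I * x + σ).re = σ := by simp
  have him : (Complex.I * x + σ).im = x := by simp
  have hi : Integrable (fun y => Real.exp ((Complex.I * x + σ).re * y)) (returnLaw p m u η v) := by
    rw [hre]
    exact (integrable_exp_returnLaw_iff hα hβ hω hη hv.le).2 (goodExponent_of_eq hσ m)
  have h1 := hle (Complex.I * x + σ) (by rw [hre]; exact hσ)
  rw [complexMGF_returnLaw hα hβ hω hη hv.le hi, Complex.norm_exp]
  rw [hre, him] at h1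
  have hpos : 0 < 1 + c * x ^ 2 := by positivity
  have h2 : Real.exp (-(1 / 2) * Real.log (1 + c * x ^ 2)) ≤ 1 / (Real.sqrt c * x) := by
    have : Real.exp (-(1 / 2) * Real.log (1 + c * x ^ 2)) = (Real.sqrt (1 + c * x ^ 2))⁻¹ := by
      rw [Real.sqrt_eq_rpow, ← Real.rpow_neg hpos.le, Real.rpow_def_of_pos hpos, mul_comm]
    rw [this, ← one_div]
    refine one_div_le_one_div_of_le (by positivity) (Real.le_sqrt_of_sq_le ?_)
    rw [mul_pow, Real.sq_sqrt hc.le]; linarith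
  have h3 : σ * p.r * m ≤ |p.r| * m := by
    refine mul_le_mul_of_nonneg_right ?_ (Nat.cast_nonneg m)
    rcases hσ with rfl | rfl
    · simp
    · rw [one_mul]; exact le_abs_self _
  calc Real.exp (coefA p η (u + m) (Complex.I * x + σ) m +
        coefB p η (u + m) (Complex.I * x + σ) m * v).re
      ≤ Real.exp (|p.r| * m + -(1 / 2) * Real.log (1 + c * x ^ 2)) :=
        Real.exp_le_exp.2 (by linarith)
    _ ≤ Real.exp (|p.r| * m) * (1 / (Real.sqrt c * x)) := by
        rw [Real.exp_add]; gcongr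
    _ = _ := by field_simp

end ReturnLaw

/-! ### Conditional laws of functions of the price and the cumulative return -/

section CondLaw

variable {Ω : Type*} {mΩ : MeasurableSpace Ω} {P Q : Measure Ω} [IsProbabilityMeasure P]
  {𝒢 : Filtration ℕ mΩ} {p : Params} {S h z φ ξ : ℕ → Ω → ℝ} {t M : ℕ}

lemma price_eq_mul_exp_cumReturn (hS : ∀ t ω, 0 < S t ω) (t M : ℕ) (ω : Ω) :
    S (t + M) ω = S t ω * Real.exp (cumReturn S t M ω) := by
  induction M with
  | zero => simp [cumReturn]
  | succ M ih =>
    rw [cumReturn, Finset.sum_range_succ, Real.exp_add, ← mul_assoc]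
    rw [cumReturn] at ih
    rw [← ih, logReturn, Real.exp_log (div_pos (hS _ _) (hS _ _)), ← add_assoc,
      mul_div_cancel₀ _ (hS _ _).ne']

lemma IsRiskNeutral.condLaw_ae_eq [IsProbabilityMeasure Q]
    (hQ : IsRiskNeutral P Q 𝒢 S h φ ξ (t + M)) (hHN : IsHestonNandi P 𝒢 p S h z)
    (hM : IsPricingKernel P 𝒢 p S h φ ξ) (hα : 0 < p.alpha)
    (hβ : 0 ≤ p.beta) (hω : 0 ≤ p.omega)
    (hη : ∀ τ, t + 1 ≤ τ → τ ≤ t + M → Measurable[𝒢 t] (varianceRiskRatio p ξ τ))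
    {F : ℝ × ℝ → ℝ} (hF : Measurable F) {Y : Ω → ℝ}
    (hY : ∀ ω, Y ω = F (S t ω, cumReturn S t M ω)) :
    ∀ᵐ ω ∂Q, condLaw Q (𝒢 t) Y ω =
      (returnLaw p M t (riskRatioPath p ξ t M ω) (varianceRiskRatio p ξ t ω * h (t + 1) ω)).map
        fun y => F (S t ω, y) := by
  have hX : Measurable[𝒢 t] fun ω => (S t ω, modelState p S h ξ t M 0 ω) :=
    (hHN.price_adapted t).prodMk (measurable_modelState hHN hM hη 0)
  have hW : Measurable (modelState p S h ξ t M M) :=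
    (measurable_modelState hHN hM hη M).mono (𝒢.le _) le_rfl
  have hG : Measurable fun q : (ℝ × ChainState) × ChainState => F (q.1.1, q.2.2.2) :=
    hF.comp (by fun_prop)
  filter_upwards [(hQ.hasCondKernel hHN hM hα hβ hω hη).condLaw_ae_eq (𝒢.le t) hX hW hG
    (ae_of_all _ hY)] with ω h1
  have hFω : Measurable fun y => F (S t ω, y) := hF.comp measurable_prodMk_left
  rw [h1, returnLaw, Measure.map_map hFω (by fun_prop),
    Kernel.comap_apply]
  simp only [modelState, cumReturn, Finset.range_zero, Finset.sum_empty, add_zero]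
  rfl

lemma IsRiskNeutral.pos_ae (hQ : IsRiskNeutral P Q 𝒢 S h φ ξ (t + M))
    (hHN : IsHestonNandi P 𝒢 p S h z)
    (hM : IsPricingKernel P 𝒢 p S h φ ξ) (hα : 0 < p.alpha)
    (hβ : 0 ≤ p.beta) (hω : 0 ≤ p.omega) :
    ∀ᵐ ω ∂Q, 0 < h (t + 1) ω ∧ ∀ τ, 0 < riskRatioPath p ξ t M ω τ := by
  have h1 : ∀ᵐ ω ∂Q, 0 < h (t + 1) ω := by
    have mh : Measurable[𝒢 (t + M)] (h (t + 1)) :=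
      (hHN.variance_predictable t).mono (𝒢.mono (by omega)) le_rfl
    exact hQ.ae_mem (mh measurableSet_Ioi) (hHN.variance_pos hα hβ hω t)
  have h2 : ∀ᵐ ω ∂Q, ∀ τ, τ ≤ t + M → 0 < varianceRiskRatio p ξ τ ω := by
    refine ae_all_iff.2 fun τ => ?_
    by_cases hτ : τ ≤ t + M
    · have mη : Measurable[𝒢 (t + M)] (varianceRiskRatio p ξ τ) :=
        (measurable_varianceRiskRatio hM τ).mono (𝒢.mono hτ) le_rfl
      filter_upwards [hQ.ae_mem (mη measurableSet_Ioi)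
        (varianceRiskRatio_pos hHN hM hα hβ hω τ)] with ω h _ using h
    · exact ae_of_all _ fun ω h => absurd h hτ
  filter_upwards [h1, h2] with ω h1 h2
  refine ⟨h1, fun τ => ?_⟩
  rw [riskRatioPath]
  split_ifs with h
  · exact h2 τ h.2
  · exact one_pos

end CondLaw

end HNOption

theorem theorem3 {Ω : Type*} {mΩ : MeasurableSpace Ω}
    (P Q : Measure Ω) [IsProbabilityMeasure P] [IsProbabilityMeasure Q]
    (𝒢 : Filtration ℕ mΩ) (p : HNOption.Params)
    (hα : 0 < p.alpha) (hβ : 0 ≤ p.beta) (hω : 0 ≤ p.omega)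
    (S h z φ ξ : ℕ → Ω → ℝ)
    (hHN : HNOption.IsHestonNandi P 𝒢 p S h z)
    (hM : HNOption.IsPricingKernel P 𝒢 p S h φ ξ)
    (t M : ℕ) (hM1 : 1 ≤ M) (K : ℝ) (hK : 0 < K)
    (hQ : HNOption.IsRiskNeutral P Q 𝒢 S h φ ξ (t + M))
    (hη : ∀ τ, t + 1 ≤ τ → τ ≤ t + M →
      Measurable[𝒢 t] (HNOption.varianceRiskRatio p ξ τ)) :
    ∀ᵐ ω ∂Q,
      -- the call price is well defined
      Integrable (fun y : ℝ => y)
        (HNOption.condLaw Q (𝒢 t) (HNOption.callPayoff S K (t + M)) ω) ∧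
      -- the Fourier-inversion integrals converge absolutely
      IntegrableOn
        (HNOption.integrandP1 K (S t ω)
          (HNOption.condMGF Q (𝒢 t) (HNOption.cumReturn S t M) ω)) (Set.Ioi 0) ∧
      IntegrableOn
        (HNOption.integrandP2 K (S t ω)
          (HNOption.condMGF Q (𝒢 t) (HNOption.cumReturn S t M) ω)) (Set.Ioi 0) ∧
      -- the pricing formula
      HNOption.callPrice Q 𝒢 p.r S t M K ω =
        S t ω * HNOption.probP1 p.r M K (S t ω)
            (HNOption.condMGF Q (𝒢 t) (HNOption.cumReturn S t M) ω)
          - K * Real.exp (-p.r * M) * HNOption.probP2 K (S t ω)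
            (HNOption.condMGF Q (𝒢 t) (HNOption.cumReturn S t M) ω) ∧
      -- the moment generating function exists at least on the strip `0 ≤ Re s ≤ 1`
      (∀ s : ℂ, 0 ≤ s.re → s.re ≤ 1 →
        Integrable (fun x : ℝ => Real.exp (s.re * x))
          (HNOption.condLaw Q (𝒢 t) (HNOption.cumReturn S t M) ω)) ∧
      -- wherever it exists, it has the exponentially affine form
      (∀ s : ℂ,
        Integrable (fun x : ℝ => Real.exp (s.re * x))
          (HNOption.condLaw Q (𝒢 t) (HNOption.cumReturn S t M) ω) →
        HNOption.condMGF Q (𝒢 t) (HNOption.cumReturn S t M) ω s =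
          Complex.exp
            (HNOption.coefA p (fun τ => HNOption.varianceRiskRatio p ξ τ ω) (t + M) s M
              + HNOption.coefB p (fun τ => HNOption.varianceRiskRatio p ξ τ ω) (t + M) s M
                * ((HNOption.varianceRiskRatio p ξ t ω * h (t + 1) ω : ℝ) : ℂ))) := by
  have hcum := hQ.condLaw_ae_eq hHN hM hα hβ hω hη (F := Prod.snd) measurable_snd
    (Y := HNOption.cumReturn S t M) fun ω => rfl
  have hpay := hQ.condLaw_ae_eq hHN hM hα hβ hω hη
    (F := fun q => max (q.1 * Real.exp q.2 - K) 0) (by fun_prop)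
    (Y := HNOption.callPayoff S K (t + M)) fun ω => by
      rw [HNOption.callPayoff, HNOption.price_eq_mul_exp_cumReturn hHN.price_pos]
  filter_upwards [hcum, hpay, hQ.pos_ae hHN hM hα hβ hω] with ω hcum hpay hpos
  obtain ⟨hh, hpath⟩ := hpos
  have hv : 0 < HNOption.varianceRiskRatio p ξ t ω * h (t + 1) ω := by
    have := hpath t
    rw [HNOption.riskRatioPath, if_pos ⟨le_rfl, by omega⟩] at this
    exact mul_pos this hh
  -- the coefficients only involve the path between `t` and `t + M - 1`
  have hagree : ∀ τ, t + M - M ≤ τ → τ < t + M →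
      HNOption.riskRatioPath p ξ t M ω τ = HNOption.varianceRiskRatio p ξ τ ω := by
    intro τ h1 h2
    rw [HNOption.riskRatioPath, if_pos ⟨by omega, h2.le⟩]
  simp only [Measure.map_id'] at hcum
  have hmgf : HNOption.condMGF Q (𝒢 t) (HNOption.cumReturn S t M) ω =
      complexMGF id (HNOption.returnLaw p M t (HNOption.riskRatioPath p ξ t M ω)
        (HNOption.varianceRiskRatio p ξ t ω * h (t + 1) ω)) := by
    funext s
    rw [HNOption.condMGF, hcum]
  obtain ⟨C, hC⟩ := HNOption.exists_norm_complexMGF_returnLaw_le (u := t) hα hβ hω hpath hv hM1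
  have hI := fun (σ : ℝ) (hσ : σ = 0 ∨ σ = 1) =>
    HNOption.mem_interior_integrableExpSet_returnLaw (m := M) (u := t) hα hβ hω hpath hv.le hσ
  obtain ⟨c1, c2, c3, c4⟩ := HNOption.call_price_formula hK (hHN.price_pos t ω)
    (hI 0 (Or.inl rfl)) (hI 1 (Or.inr rfl))
    (HNOption.integral_exp_returnLaw hα hβ hω hpath hv.le) hC
  have hpm : Measurable fun y : ℝ => max (S t ω * Real.exp y - K) 0 := by fun_prop
  rw [HNOption.callPrice, HNOption.condMean, hmgf, hpay, hcum]
  refine ⟨?_, c2, c3, ?_, ?_, ?_⟩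
  · rw [integrable_map_measure (by fun_prop) hpm.aemeasurable]
    exact c1
  · rw [integral_map hpm.aemeasurable (by fun_prop)]
    exact c4
  · -- the set of real exponents with a finite moment is convex
    intro s h0 h1
    exact convex_integrableExpSet.ordConnected.out
      (interior_subset (hI 0 (Or.inl rfl))) (interior_subset (hI 1 (Or.inr rfl))) ⟨h0, h1⟩
  · intro s hs
    rw [HNOption.complexMGF_returnLaw hα hβ hω hpath hv.le hs,
      HNOption.coefA_congr (Nat.le_add_left M t) hagree,
      HNOption.coefB_congr (Nat.le_add_left M t) hagree]
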